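/- **Termination-insensitive non-interference for $\lambda^{\mathrm{LIO}}_{\mathcal L,\mathrm{FS+AU}}$.** *The calculus.* Let $(\mathcal L,\sqsubseteq,\sqcup,\sqcap)$ be a lattice of labels. Terms are those of a simply typed call-by-name $\lambda$-calculus ($\mathsf{True}$, $\mathsf{False}$, $()$, $\lambda x.t$, $x$, $t\,t$, $\mathsf{fix}\,t$, conditionals), labels $\ell\in\mathcal L$ and the operations $\sqcup,\sqcap,\sqsubseteq$ on them, $\mathsf{return}\,t$, $t\mathbin{>\!\!>\!\!=}t$, $\mathsf{getLabel}$, $\mathsf{label}\,t\,t$, $\mathsf{unlabel}\,t$, $\mathsf{labelOf}\,t$, $\mathsf{toLabeled}\,t\,t$, for $s\in\{\mathrm{FI},\mathrm{FS}\}$ (flow-insensitive and flow-sensitive references) $\mathsf{newRef}_s\,t\,t$, $\mathsf{readRef}_s\,t$, $\mathsf{writeRef}_s\,t\,t$, $\mathsf{labelOf}_s\,t$, further $\mathsf{copyRef}\,t\,t$, $\mathsf{upgrade}\,t\,t$, $\mathsf{downgrade}\,t\,t$, $\mathsf{upgradeStore}\,\ell$, a term $\Uparrow$ without reduction rule, and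 the internal (TCB) nodes $\mathrm{LIO}\,t$, $\mathrm{Lb}\,\ell\,t$, $\mathrm{Ref}_{\mathrm{FI}}\,\ell\,a$, $\mathrm{Ref}_{\mathrm{FS}}\,a$ with $a$ a memory address. Values are $\mathsf{True}$, $\mathsf{False}$, $()$, abstractions, labels and the internal nodes. Typing is the standard one: $\mathrm{LIO}\,\tau$ is the type of computations, $\mathrm{Labeled}\,\tau$ that of labeled values, $\mathrm{Ref}_s\,\tau$ that of references. An environment is $\Sigma=(l_{\mathrm{cur}},\mu_{\mathrm{FI}},\mu_{\mathrm{FS}})$ with a current label and two finite stores; $\mu_{\mathrm{FI}}(a)$ has the form $\mathrm{Lb}\,l\,t$ and $\mu_{\mathrm{FS}}(a)$ the form $\mathrm{Lb}\,l_o\,(\mathrm{Lb}\,l_d\,t)$. It is well formed if every reference occurring in a stored term is allocated, and the label carried by a flow-insensitive reference is the label of its cell. Below, "requires" states a side condition without which the term is stuck, and stores not mentioned are unchanged. Pure reduction is standard: besides the usual rules of the $\lambda$-calculus and the operations on labels, $\mathsf{labelOf}\,(\mathrm{Lb}\,l\,t)\to l$ and $\mathsf{labelOf}_{\mathrm{FI}}(\mathrm{Ref}_{\mathrm{FI}}\,l\,a)\to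 l$; it takes place in the function position, under $\mathsf{fix}$, in the condition of a conditional, in the arguments of the label operations, of $\mathsf{copyRef}$, of $\mathsf{upgrade}$ and of $\mathsf{downgrade}$ (from left to right), and in the first argument of the other operators except $\mathsf{return}$ and bind. Configurations $\langle\Sigma\mid t\rangle$ reduce by pure steps, in the first argument of bind, and by the following rules. - $\mathsf{return}\,t\to\mathrm{LIO}\,t$; $(\mathrm{LIO}\,t)\mathbin{>\!\!>\!\!=}u\to u\,t$; $\mathsf{getLabel}\to\mathsf{return}\,l_{\mathrm{cur}}$; $\mathsf{label}\,l\,t\to\mathsf{return}\,(\mathrm{Lb}\,l\,t)$, requires $l_{\mathrm{cur}}\sqsubseteq l$. - $\mathsf{toLabeled}\,l\,t$ requires $l_{\mathrm{cur}}\sqsubseteq l$, runs $\langle\Sigma\mid t\rangle\to^*\langle\Sigma'\mid\mathrm{LIO}\,t'\rangle$, requires that the current label of $\Sigma'$ flows to $l$, and becomes $\mathsf{label}\,l\,t'$ with the stores of $\Sigma'$ and the current label of $\Sigma$. - $\mathsf{newRef}_{\mathrm{FI}}\,l\,t$ requires $l_{\mathrm{cur}}\sqsubseteq l$, picks any address $a$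 allocated in neither store, sets $\mu_{\mathrm{FI}}(a)=\mathrm{Lb}\,l\,t$ and returns $\mathrm{Ref}_{\mathrm{FI}}\,l\,a$; $\mathsf{readRef}_{\mathrm{FI}}(\mathrm{Ref}_{\mathrm{FI}}\,l\,a)\to\mathsf{unlabel}\,\mu_{\mathrm{FI}}(a)$; $\mathsf{writeRef}_{\mathrm{FI}}(\mathrm{Ref}_{\mathrm{FI}}\,l\,a)\,t$ requires $l_{\mathrm{cur}}\sqsubseteq l$, sets $\mu_{\mathrm{FI}}(a)=\mathrm{Lb}\,l\,t$ and returns $()$; $\mathsf{copyRef}(\mathrm{Ref}_{\mathrm{FI}}\,l_1\,a_1)(\mathrm{Ref}_{\mathrm{FI}}\,l_2\,a_2)$ requires $l_1\sqsubseteq l_2$, $l_{\mathrm{cur}}\sqsubseteq l_2$ and $\mu_{\mathrm{FI}}(a_1)=\mathrm{Lb}\,l_1\,t$, sets $\mu_{\mathrm{FI}}(a_2)=\mathrm{Lb}\,l_2\,t$ and returns $()$. - $\mathsf{newRef}_{\mathrm{FS}}\,l\,t$ requires $l_{\mathrm{cur}}\sqsubseteq l$, picks any address $a$ allocated in neither store,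 sets $\mu_{\mathrm{FS}}(a)=\mathrm{Lb}\,l_{\mathrm{cur}}(\mathrm{Lb}\,l\,t)$ and returns $\mathrm{Ref}_{\mathrm{FS}}\,a$. If $\mu_{\mathrm{FS}}(a)=\mathrm{Lb}\,l_o(\mathrm{Lb}\,l_d\,t)$ and $r=\mathrm{Ref}_{\mathrm{FS}}\,a$, then: $\mathsf{readRef}_{\mathrm{FS}}\,r\to\mathsf{unlabel}\,(\mathrm{Lb}\,(l_o\sqcup l_d)\,t)$; $\mathsf{labelOf}_{\mathrm{FS}}\,r\to\mathsf{unlabel}\,(\mathrm{Lb}\,l_o\,l_d)$; $\mathsf{writeRef}_{\mathrm{FS}}\,r\,t'$ replaces $t$ by $t'$ and returns $()$ if $l_{\mathrm{cur}}\sqsubseteq l_o\sqcup l_d$, and becomes $\mathsf{unlabel}\,(\mathrm{Lb}\,l_o\Uparrow)$ otherwise; $\mathsf{upgrade}\,r\,l'$ requires $l_{\mathrm{cur}}\sqsubseteq l_o$, replaces $l_d$ by $l_d\sqcup l'$ and returns $()$; $\mathsf{downgrade}\,r\,l'$ requires $l_{\mathrm{cur}}\sqsubseteq l_o$, replaces $l_d$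 by $l_o\sqcup(l_d\sqcap l')$ and $t$ by $\Uparrow$ and returns $()$. - $\mathsf{upgradeStore}\,l$ becomes the sequence of all $\mathsf{upgrade}\,(\mathrm{Ref}_{\mathrm{FS}}\,a)\,l$ with $a$ in the domain of $\mu_{\mathrm{FS}}$ ($\mathsf{return}\,()$ if it is empty). - Automatic upgrade: if $l'=l_{\mathrm{cur}}\sqcup l$ and $\langle\Sigma\mid\mathsf{upgradeStore}\,l'\rangle\to^*\langle l_{\mathrm{cur}},\mu_{\mathrm{FI}},\mu_{\mathrm{FS}}'\mid\mathrm{LIO}\,()\rangle$, then $\langle\Sigma\mid\mathsf{unlabel}\,(\mathrm{Lb}\,l\,t)\rangle\to\langle l',\mu_{\mathrm{FI}},\mu_{\mathrm{FS}}'\mid\mathsf{return}\,t\rangle$. *Low equivalence.* The erasure of a term at level $l$ replaces, in every $\mathrm{Lb}\,k\,t$ with $k\not\sqsubseteq l$, the contents $t$ by $\bullet$. Terms are $l$-equivalent, $t_1\approx_l t_2$, if their erasures are equal. The erasure of a configuration erases the current label and the term if the current label does not flow to $l$, and otherwise erases the term as above; it removes the cells $\mathrm{Lb}\,k\,t$ of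 $\mu_{\mathrm{FI}}$ with $k\not\sqsubseteq l$ and the cells $\mathrm{Lb}\,l_o(\mathrm{Lb}\,l_d\,t)$ of $\mu_{\mathrm{FS}}$ with $l_o\not\sqsubseteq l$, replaces the contents $t$ of the remaining cells of $\mu_{\mathrm{FS}}$ with $l_d\not\sqsubseteq l$ by $\bullet$, and erases the contents of all other cells as terms. *Theorem.* Let $l\in\mathcal L$ be the attacker's observation level, let $\Sigma$ be a well-formed environment, and let $t_1,t_2$ be closed well-typed terms of $\mathrm{LIO}$ types that contain no internal nodes except possibly labeled values $\mathrm{Lb}\,k\,t$, with $t_1\approx_l t_2$. If $$\langle\Sigma\mid t_1\rangle\to^*\langle\Sigma_1\mid v_1\rangle\quad\text{and}\quad\langle\Sigma\mid t_2\rangle\to^*\langle\Sigma_2\mid v_2\rangle$$ with values $v_1,v_2$, then $\langle\Sigma_1\mid v_1\rangle\approx_l\langle\Sigma_2\mid v_2\rangle$: there is a permutation of the addresses that fixes all addresses allocated in $\Sigma$ and maps the erasure of $\langle\Sigma_1\mid v_1\rangle$ at level $l$ to that of $\langle\Sigma_2\mid v_2\rangle$. -/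

import Mathlib

namespace FlowSens

/-- Memory addresses. -/
abbrev Addr := ℕ

/-- The two kinds of references: flow-insensitive and flow-sensitive. -/
inductive Sens
  | fi
  | fs

/-- Types. -/
inductive Ty
  | bool
  | unit
  | label
  | arr (a b : Ty)
  | lio (a : Ty)
  | labeled (a : Ty)
  | ref (s : Sens) (a : Ty)

/-- Unary term formers. `labelOf` inspects a labeled value, `labelOfRef s` a reference. -/
inductive UnOp
  | fix
  | ret
  | unlabel
  | labelOf
  | readRef (s : Sens)
  | labelOfRef (s : Sens)

/-- Binary term formers. `join`, `meet`, `le` are the label operations. -/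
inductive BinOp
  | app
  | bind
  | join
  | meet
  | le
  | label
  | toLabeled
  | newRef (s : Sens)
  | writeRef (s : Sens)
  | copyRef
  | upgrade
  | downgrade

/-- Terms over the label type `L`, with de Bruijn indices for variables.
The nodes `lio`, `lb`, `refFI`, `refFS` are the internal (TCB) ones.  `diverge` is the divergent
term, for which there is no reduction rule.  `bullet` is not a term of the calculus: it only
appears in the results of erasure, has no type and no reduction rule. -/
inductive Term (L : Type*)
  | var (n : ℕ)
  | tt
  | ff
  | unit
  | lbl (l : L)
  | lam (t : Term L)
  | lio (t : Term L)
  | lb (l : L) (t : Term L)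
  | refFI (l : L) (a : Addr)
  | refFS (a : Addr)
  | diverge
  | getLabel
  | upgradeStore (l : L)
  | un (o : UnOp) (t : Term L)
  | bin (o : BinOp) (t u : Term L)
  | ite (t u w : Term L)
  | bullet

namespace Term

variable {L : Type*}

/-- The values of the calculus. -/
inductive IsValue : Term L → Prop
  | tt : IsValue tt
  | ff : IsValue ff
  | unit : IsValue unit
  | lbl (l : L) : IsValue (lbl l)
  | lam (t : Term L) : IsValue (lam t)
  | lio (t : Term L) : IsValue (lio t)
  | lb (l : L) (t : Term L) : IsValue (lb l t)
  | refFI (l : L) (a : Addr) : IsValue (refFI l a)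
  | refFS (a : Addr) : IsValue (refFS a)

/-- Extend a renaming of variables under a binder. -/
def liftRen (ξ : ℕ → ℕ) : ℕ → ℕ
  | 0 => 0
  | n + 1 => ξ n + 1

/-- Rename variables. -/
def ren (ξ : ℕ → ℕ) : Term L → Term L
  | var n => var (ξ n)
  | tt => tt
  | ff => ff
  | unit => unit
  | lbl l => lbl l
  | lam t => lam (ren (liftRen ξ) t)
  | lio t => lio (ren ξ t)
  | lb l t => lb l (ren ξ t)
  | refFI l a => refFI l a
  | refFS a => refFS a
  | diverge => diverge
  | getLabel => getLabel
  | upgradeStore l => upgradeStore l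
  | un o t => un o (ren ξ t)
  | bin o t u => bin o (ren ξ t) (ren ξ u)
  | ite t u w => ite (ren ξ t) (ren ξ u) (ren ξ w)
  | bullet => bullet

/-- Extend a substitution under a binder. -/
def liftSub (σ : ℕ → Term L) : ℕ → Term L
  | 0 => var 0
  | n + 1 => ren Nat.succ (σ n)

/-- Simultaneous capture-avoiding substitution. -/
def sub (σ : ℕ → Term L) : Term L → Term L
  | var n => σ n
  | tt => tt
  | ff => ff
  | unit => unit
  | lbl l => lbl l
  | lam t => lam (sub (liftSub σ) t)
  | lio t => lio (sub σ t)
  | lb l t => lb l (sub σ t)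
  | refFI l a => refFI l a
  | refFS a => refFS a
  | diverge => diverge
  | getLabel => getLabel
  | upgradeStore l => upgradeStore l
  | un o t => un o (sub σ t)
  | bin o t u => bin o (sub σ t) (sub σ u)
  | ite t u w => ite (sub σ t) (sub σ u) (sub σ w)
  | bullet => bullet

/-- `inst t u` is `t` with the outermost variable replaced by `u`. -/
def inst (t u : Term L) : Term L :=
  sub (fun n => match n with
    | 0 => u
    | k + 1 => var k) t

/-- Rename the memory addresses that occur in a term. -/
def mapAddr (f : Addr → Addr) : Term L → Term L
  | var n => var n
  | tt => tt
  | ff => ff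
  | unit => unit
  | lbl l => lbl l
  | lam t => lam (mapAddr f t)
  | lio t => lio (mapAddr f t)
  | lb l t => lb l (mapAddr f t)
  | refFI l a => refFI l (f a)
  | refFS a => refFS (f a)
  | diverge => diverge
  | getLabel => getLabel
  | upgradeStore l => upgradeStore l
  | un o t => un o (mapAddr f t)
  | bin o t u => bin o (mapAddr f t) (mapAddr f u)
  | ite t u w => ite (mapAddr f t) (mapAddr f u) (mapAddr f w)
  | bullet => bullet

open Classical in
/-- Erasure for an observer at level `l`: the contents of a labeled value whose label does not
flow to `l` are replaced by `bullet`; all other term formers are treated homomorphically. -/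
noncomputable def erase [LE L] (l : L) : Term L → Term L
  | var n => var n
  | tt => tt
  | ff => ff
  | unit => unit
  | lbl k => lbl k
  | lam t => lam (erase l t)
  | lio t => lio (erase l t)
  | lb k t => lb k (if k ≤ l then erase l t else bullet)
  | refFI k a => refFI k a
  | refFS a => refFS a
  | diverge => diverge
  | getLabel => getLabel
  | upgradeStore k => upgradeStore k
  | un o t => un o (erase l t)
  | bin o t u => bin o (erase l t) (erase l u)
  | ite t u w => ite (erase l t) (erase l u) (erase l w)
  | bullet => bullet

/-- Terms without internal (TCB) nodes, except that labeled values `lb` are admitted, so that two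
`l`-equivalent programs may carry different secrets. -/
def NoTCBExceptLb : Term L → Prop
  | lam t => NoTCBExceptLb t
  | lb _ t => NoTCBExceptLb t
  | un _ t => NoTCBExceptLb t
  | bin _ t u => NoTCBExceptLb t ∧ NoTCBExceptLb u
  | ite t u w => NoTCBExceptLb t ∧ NoTCBExceptLb u ∧ NoTCBExceptLb w
  | lio _ => False
  | refFI _ _ => False
  | refFS _ => False
  | bullet => False
  | _ => True

/-- `upgrade a₁ l >> ⋯ >> upgrade aₙ l`, where `t >> t'` is bind with a function that discards its
argument (the terms are closed, so no index has to be shifted); `return ()` when `n = 0`. -/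
def upgradeAll (l : L) : List Addr → Term L
  | [] => un .ret unit
  | [a] => bin .upgrade (refFS a) (lbl l)
  | a :: b :: as => bin .bind (bin .upgrade (refFS a) (lbl l)) (lam (upgradeAll l (b :: as)))

end Term

section Typing

variable {L : Type*}

/-- The typing judgement `Δ, Γ ⊢ t : τ`; `Δ` is the store typing. -/
inductive HasType (Δ : Sens → Addr → Option Ty) : List Ty → Term L → Ty → Prop
  | var {Γ n τ} : Γ[n]? = some τ → HasType Δ Γ (.var n) τ
  | tt {Γ} : HasType Δ Γ .tt .bool
  | ff {Γ} : HasType Δ Γ .ff .bool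
  | unit {Γ} : HasType Δ Γ .unit .unit
  | lbl {Γ l} : HasType Δ Γ (.lbl l) .label
  | lam {Γ t τ τ'} : HasType Δ (τ :: Γ) t τ' → HasType Δ Γ (.lam t) (.arr τ τ')
  | lio {Γ t τ} : HasType Δ Γ t τ → HasType Δ Γ (.lio t) (.lio τ)
  | lb {Γ l t τ} : HasType Δ Γ t τ → HasType Δ Γ (.lb l t) (.labeled τ)
  | refFI {Γ l a τ} : Δ .fi a = some τ → HasType Δ Γ (.refFI l a) (.ref .fi τ)
  | refFS {Γ a τ} : Δ .fs a = some τ → HasType Δ Γ (.refFS a) (.ref .fs τ)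
  | diverge {Γ τ} : HasType Δ Γ .diverge τ
  | getLabel {Γ} : HasType Δ Γ .getLabel (.lio .label)
  | upgradeStore {Γ l} : HasType Δ Γ (.upgradeStore l) (.lio .unit)
  | fix {Γ t τ} : HasType Δ Γ t (.arr τ τ) → HasType Δ Γ (.un .fix t) τ
  | ret {Γ t τ} : HasType Δ Γ t τ → HasType Δ Γ (.un .ret t) (.lio τ)
  | unlabel {Γ t τ} : HasType Δ Γ t (.labeled τ) → HasType Δ Γ (.un .unlabel t) (.lio τ)
  | labelOf {Γ t τ} : HasType Δ Γ t (.labeled τ) → HasType Δ Γ (.un .labelOf t) .label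
  | readRef {Γ s t τ} : HasType Δ Γ t (.ref s τ) → HasType Δ Γ (.un (.readRef s) t) (.lio τ)
  | labelOfFI {Γ t τ} : HasType Δ Γ t (.ref .fi τ) → HasType Δ Γ (.un (.labelOfRef .fi) t) .label
  | labelOfFS {Γ t τ} :
      HasType Δ Γ t (.ref .fs τ) → HasType Δ Γ (.un (.labelOfRef .fs) t) (.lio .label)
  | app {Γ t u τ τ'} :
      HasType Δ Γ t (.arr τ τ') → HasType Δ Γ u τ → HasType Δ Γ (.bin .app t u) τ'
  | bind {Γ t u τ τ'} :
      HasType Δ Γ t (.lio τ) → HasType Δ Γ u (.arr τ (.lio τ')) →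
        HasType Δ Γ (.bin .bind t u) (.lio τ')
  | join {Γ t u} :
      HasType Δ Γ t .label → HasType Δ Γ u .label → HasType Δ Γ (.bin .join t u) .label
  | meet {Γ t u} :
      HasType Δ Γ t .label → HasType Δ Γ u .label → HasType Δ Γ (.bin .meet t u) .label
  | le {Γ t u} :
      HasType Δ Γ t .label → HasType Δ Γ u .label → HasType Δ Γ (.bin .le t u) .bool
  | label {Γ t u τ} :
      HasType Δ Γ t .label → HasType Δ Γ u τ → HasType Δ Γ (.bin .label t u) (.lio (.labeled τ))
  | toLabeled {Γ t u τ} :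
      HasType Δ Γ t .label → HasType Δ Γ u (.lio τ) →
        HasType Δ Γ (.bin .toLabeled t u) (.lio (.labeled τ))
  | newRef {Γ s t u τ} :
      HasType Δ Γ t .label → HasType Δ Γ u τ →
        HasType Δ Γ (.bin (.newRef s) t u) (.lio (.ref s τ))
  | writeRef {Γ s t u τ} :
      HasType Δ Γ t (.ref s τ) → HasType Δ Γ u τ →
        HasType Δ Γ (.bin (.writeRef s) t u) (.lio .unit)
  | copyRef {Γ t u τ} :
      HasType Δ Γ t (.ref .fi τ) → HasType Δ Γ u (.ref .fi τ) →
        HasType Δ Γ (.bin .copyRef t u) (.lio .unit)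
  | upgrade {Γ t u τ} :
      HasType Δ Γ t (.ref .fs τ) → HasType Δ Γ u .label →
        HasType Δ Γ (.bin .upgrade t u) (.lio .unit)
  | downgrade {Γ t u τ} :
      HasType Δ Γ t (.ref .fs τ) → HasType Δ Γ u .label →
        HasType Δ Γ (.bin .downgrade t u) (.lio .unit)
  | ite {Γ t u w τ} :
      HasType Δ Γ t .bool → HasType Δ Γ u τ → HasType Δ Γ w τ → HasType Δ Γ (.ite t u w) τ

end Typing

/-- The state of a configuration: the current label, the flow-insensitive store, which maps an
address to a labeled value `Lb l t` (stored as `(l, t)`), and the flow-sensitive store, which maps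
an address to a doubly labeled value `Lb lo (Lb ld t)` (stored as `(lo, ld, t)`). -/
structure Env (L : Type*) where
  cur : L
  fi : Addr → Option (L × Term L)
  fs : Addr → Option (L × L × Term L)

namespace Env

variable {L : Type*}

/-- The allocated addresses. -/
def dom (S : Env L) : Set Addr := {a | S.fi a ≠ none ∨ S.fs a ≠ none}

/-- The references that occur in a term are allocated in `S`; the label that a flow-insensitive
reference carries is that of its memory cell. -/
def RefsOK (S : Env L) : Term L → Prop
  | .refFI l a => ∃ t, S.fi a = some (l, t)
  | .refFS a => ∃ c, S.fs a = some c
  | .lam t => RefsOK S t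
  | .lio t => RefsOK S t
  | .lb _ t => RefsOK S t
  | .un _ t => RefsOK S t
  | .bin _ t u => RefsOK S t ∧ RefsOK S u
  | .ite t u w => RefsOK S t ∧ RefsOK S u ∧ RefsOK S w
  | _ => True

/-- Well-formed environments: both stores are finite and contain no dangling reference. -/
structure WellFormed (S : Env L) : Prop where
  finite : S.dom.Finite
  fi_ok : ∀ a l t, S.fi a = some (l, t) → S.RefsOK t
  fs_ok : ∀ a lo ld t, S.fs a = some (lo, ld, t) → S.RefsOK t

end Env

section Semantics

variable {L : Type*} [Lattice L]

/-- Unary operators that evaluate their argument. -/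
def UnOp.Strict : UnOp → Prop
  | .ret => False
  | _ => True

/-- Binary operators whose first argument is a position of a pure evaluation context. -/
def BinOp.StrictLeft : BinOp → Prop
  | .bind => False
  | _ => True

/-- Binary operators that also evaluate the second argument, once the first one is a value. -/
def BinOp.StrictRight : BinOp → Prop
  | .join => True
  | .meet => True
  | .le => True
  | .copyRef => True
  | .upgrade => True
  | .downgrade => True
  | _ => False

/-- Pure reduction. The last four rules close the redexes under pure evaluation contexts. -/
inductive PureStep : Term L → Term L → Prop
  | app {t u} : PureStep (.bin .app (.lam t) u) (t.inst u)
  | fix {t} : PureStep (.un .fix (.lam t)) (t.inst (.un .fix (.lam t)))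
  | ifTrue {u w} : PureStep (.ite .tt u w) u
  | ifFalse {u w} : PureStep (.ite .ff u w) w
  | join {l k} : PureStep (.bin .join (.lbl l) (.lbl k)) (.lbl (l ⊔ k))
  | meet {l k} : PureStep (.bin .meet (.lbl l) (.lbl k)) (.lbl (l ⊓ k))
  | leTrue {l k} : l ≤ k → PureStep (.bin .le (.lbl l) (.lbl k)) .tt
  | leFalse {l k} : ¬ l ≤ k → PureStep (.bin .le (.lbl l) (.lbl k)) .ff
  | labelOf {l t} : PureStep (.un .labelOf (.lb l t)) (.lbl l)
  | labelOfFI {l a} : PureStep (.un (.labelOfRef .fi) (.refFI l a)) (.lbl l)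
  | unCtx {o t t'} : o.Strict → PureStep t t' → PureStep (.un o t) (.un o t')
  | leftCtx {o t t' u} : o.StrictLeft → PureStep t t' → PureStep (.bin o t u) (.bin o t' u)
  | rightCtx {o v u u'} : o.StrictRight → v.IsValue → PureStep u u' →
      PureStep (.bin o v u) (.bin o v u')
  | iteCtx {t t' u w} : PureStep t t' → PureStep (.ite t u w) (.ite t' u w)

mutual

/-- `Step S t S' t'` is the reduction `⟨S | t⟩ ⟶ ⟨S' | t'⟩` of the calculus with automatic
upgrades. Monadic evaluation contexts are iterated left arguments of bind (rule `bindCtx`). -/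
inductive Step : Env L → Term L → Env L → Term L → Prop
  | pure {S t t'} : PureStep t t' → Step S t S t'
  | bindCtx {S t S' t' u} : Step S t S' t' → Step S (.bin .bind t u) S' (.bin .bind t' u)
  | ret {S t} : Step S (.un .ret t) S (.lio t)
  | bind {S t u} : Step S (.bin .bind (.lio t) u) S (.bin .app u t)
  | getLabel {S} : Step S .getLabel S (.un .ret (.lbl S.cur))
  | label {S l t} : S.cur ≤ l → Step S (.bin .label (.lbl l) t) S (.un .ret (.lb l t))
  /- all references are upgraded to the new current label before the current label is raised -/
  | unlabel {S l t μ} :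
      Steps S (.upgradeStore (S.cur ⊔ l)) { S with fs := μ } (.lio .unit) →
      Step S (.un .unlabel (.lb l t)) { S with cur := S.cur ⊔ l, fs := μ } (.un .ret t)
  /- the list enumerates the addresses of the flow-sensitive store, in any order -/
  | upgradeStore {S l} {as : List Addr} : as.Nodup → (∀ a, a ∈ as ↔ S.fs a ≠ none) →
      Step S (.upgradeStore l) S (Term.upgradeAll l as)
  /- the current label is restored, the stores are kept -/
  | toLabeled {S S' l t t'} : S.cur ≤ l → Steps S t S' (.lio t') → S'.cur ≤ l →
      Step S (.bin .toLabeled (.lbl l) t) { S' with cur := S.cur } (.bin .label (.lbl l) t')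
  | newRefFI {S l t a} : S.cur ≤ l → a ∉ S.dom →
      Step S (.bin (.newRef .fi) (.lbl l) t)
        { S with fi := Function.update S.fi a (some (l, t)) } (.un .ret (.refFI l a))
  | readRefFI {S l a l' t} : S.fi a = some (l', t) →
      Step S (.un (.readRef .fi) (.refFI l a)) S (.un .unlabel (.lb l' t))
  | writeRefFI {S l a t} : S.cur ≤ l →
      Step S (.bin (.writeRef .fi) (.refFI l a) t)
        { S with fi := Function.update S.fi a (some (l, t)) } (.un .ret .unit)
  | copyRef {S l₁ a₁ l₂ a₂ t} : l₁ ≤ l₂ → S.cur ≤ l₂ → S.fi a₁ = some (l₁, t) →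
      Step S (.bin .copyRef (.refFI l₁ a₁) (.refFI l₂ a₂))
        { S with fi := Function.update S.fi a₂ (some (l₂, t)) } (.un .ret .unit)
  | newRefFS {S l t a} : S.cur ≤ l → a ∉ S.dom →
      Step S (.bin (.newRef .fs) (.lbl l) t)
        { S with fs := Function.update S.fs a (some (S.cur, l, t)) } (.un .ret (.refFS a))
  | readRefFS {S a l l' t} : S.fs a = some (l, l', t) →
      Step S (.un (.readRef .fs) (.refFS a)) S (.un .unlabel (.lb (l ⊔ l') t))
  | writeRefFS {S a l l' t' t} : S.fs a = some (l, l', t') → S.cur ≤ l ⊔ l' →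
      Step S (.bin (.writeRef .fs) (.refFS a) t)
        { S with fs := Function.update S.fs a (some (l, l', t)) } (.un .ret .unit)
  | writeRefFSFail {S a l l' t' t} : S.fs a = some (l, l', t') → ¬ S.cur ≤ l ⊔ l' →
      Step S (.bin (.writeRef .fs) (.refFS a) t) S (.un .unlabel (.lb l .diverge))
  | labelOfFS {S a l l' t} : S.fs a = some (l, l', t) →
      Step S (.un (.labelOfRef .fs) (.refFS a)) S (.un .unlabel (.lb l (.lbl l')))
  | upgrade {S a l l' l'' t} : S.fs a = some (l, l'', t) → S.cur ≤ l →
      Step S (.bin .upgrade (.refFS a) (.lbl l'))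
        { S with fs := Function.update S.fs a (some (l, l'' ⊔ l', t)) } (.un .ret .unit)
  | downgrade {S a l l' l'' t} : S.fs a = some (l, l'', t) → S.cur ≤ l →
      Step S (.bin .downgrade (.refFS a) (.lbl l'))
        { S with fs := Function.update S.fs a (some (l, l ⊔ (l'' ⊓ l'), .diverge)) }
        (.un .ret .unit)

/-- The reflexive and transitive closure of `Step`. -/
inductive Steps : Env L → Term L → Env L → Term L → Prop
  | refl {S t} : Steps S t S t
  | head {S t S' t' S'' t''} : Step S t S' t' → Steps S' t' S'' t'' → Steps S t S'' t''

end

end Semantics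

section Equivalence

variable {L : Type*}

/-- Erased configurations; `cur = none` stands for an erased current label. -/
@[ext]
structure ErasedConf (L : Type*) where
  cur : Option L
  fi : Addr → Option (L × Term L)
  fs : Addr → Option (L × L × Term L)
  tm : Term L

open Classical in
/-- Erasure of a configuration for an observer at level `l`.  The current label protects itself and
the term.  A flow-insensitive cell `Lb k t` is visible iff `k ≤ l`.  A flow-sensitive cell
`Lb lo (Lb ld t)` and its label `ld` are visible iff `lo ≤ l`, and its contents iff also
`ld ≤ l`. -/
noncomputable def eraseConf [LE L] (l : L) (S : Env L) (t : Term L) : ErasedConf L where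
  cur := if S.cur ≤ l then some S.cur else none
  fi a := (S.fi a).bind fun c => if c.1 ≤ l then some (c.1, c.2.erase l) else none
  fs a := (S.fs a).bind fun c =>
    if c.1 ≤ l then some (c.1, c.2.1, if c.2.1 ≤ l then c.2.2.erase l else .bullet) else none
  tm := if S.cur ≤ l then t.erase l else .bullet

/-- Rename the addresses of an erased configuration by a permutation. -/
def ErasedConf.permute (π : Equiv.Perm Addr) (c : ErasedConf L) : ErasedConf L where
  cur := c.cur
  fi a := (c.fi (π.symm a)).map fun d => (d.1, d.2.mapAddr π)
  fs a := (c.fs (π.symm a)).map fun d => (d.1, d.2.1, d.2.2.mapAddr π)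
  tm := c.tm.mapAddr π

/-- `l`-equivalence of terms: syntactic equality after erasure. -/
def TermEquiv [LE L] (l : L) (t₁ t₂ : Term L) : Prop := t₁.erase l = t₂.erase l

/-- `l`-equivalence of configurations: syntactic equality after erasure, up to the choice of the
addresses outside `A` (the addresses picked by the freshness condition during the two runs). -/
def ConfEquiv [LE L] (l : L) (A : Set Addr) (S₁ : Env L) (t₁ : Term L) (S₂ : Env L) (t₂ : Term L) :
    Prop :=
  ∃ π : Equiv.Perm Addr, (∀ a ∈ A, π a = a) ∧
    (eraseConf l S₁ t₁).permute π = eraseConf l S₂ t₂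

end Equivalence

end FlowSens

namespace FlowSens

variable {L : Type*}

/-- The flow-sensitive store after every cell has been upgraded to `k`. -/
def Env.upgraded [Lattice L] (S : Env L) (k : L) : Addr → Option (L × L × Term L) :=
  fun a => (S.fs a).map fun c => (c.1, c.2.1 ⊔ k, c.2.2)

/-- The current label flows to the outer label of every flow-sensitive cell. -/
def Env.Upgradable [Lattice L] (S : Env L) : Prop :=
  ∀ a lo ld t, S.fs a = some (lo, ld, t) → S.cur ≤ lo

theorem Term.sub_upgradeAll (k : L) (as : List Addr) (σ : ℕ → Term L) :
    (upgradeAll k as).sub σ = upgradeAll k as := by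
  induction as generalizing σ with
  | nil => rfl
  | cons a as ih =>
    cases as with
    | nil => rfl
    | cons b as => simp [upgradeAll, sub, ih]

section BigStep

variable [Lattice L]

/-- The impure steps other than `bind` and `toLabeled`, with the upgrade of the whole store treated
as one atomic step. -/
inductive Act : Env L → Term L → Env L → Term L → Prop
  | ret {S t} : Act S (.un .ret t) S (.lio t)
  | getLabel {S} : Act S .getLabel S (.un .ret (.lbl S.cur))
  | label {S l t} : S.cur ≤ l → Act S (.bin .label (.lbl l) t) S (.un .ret (.lb l t))
  | unlabel {S l t} : S.Upgradable →
      Act S (.un .unlabel (.lb l t))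
        { S with cur := S.cur ⊔ l, fs := S.upgraded (S.cur ⊔ l) } (.un .ret t)
  | upgradeStore {S l} : S.Upgradable →
      Act S (.upgradeStore l) { S with fs := S.upgraded l } (.lio .unit)
  | newRefFI {S l t a} : S.cur ≤ l → a ∉ S.dom →
      Act S (.bin (.newRef .fi) (.lbl l) t)
        { S with fi := Function.update S.fi a (some (l, t)) } (.un .ret (.refFI l a))
  | readRefFI {S l a l' t} : S.fi a = some (l', t) →
      Act S (.un (.readRef .fi) (.refFI l a)) S (.un .unlabel (.lb l' t))
  | writeRefFI {S l a t} : S.cur ≤ l →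
      Act S (.bin (.writeRef .fi) (.refFI l a) t)
        { S with fi := Function.update S.fi a (some (l, t)) } (.un .ret .unit)
  | copyRef {S l₁ a₁ l₂ a₂ t} : l₁ ≤ l₂ → S.cur ≤ l₂ → S.fi a₁ = some (l₁, t) →
      Act S (.bin .copyRef (.refFI l₁ a₁) (.refFI l₂ a₂))
        { S with fi := Function.update S.fi a₂ (some (l₂, t)) } (.un .ret .unit)
  | newRefFS {S l t a} : S.cur ≤ l → a ∉ S.dom →
      Act S (.bin (.newRef .fs) (.lbl l) t)
        { S with fs := Function.update S.fs a (some (S.cur, l, t)) } (.un .ret (.refFS a))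
  | readRefFS {S a l l' t} : S.fs a = some (l, l', t) →
      Act S (.un (.readRef .fs) (.refFS a)) S (.un .unlabel (.lb (l ⊔ l') t))
  | writeRefFS {S a l l' t' t} : S.fs a = some (l, l', t') → S.cur ≤ l ⊔ l' →
      Act S (.bin (.writeRef .fs) (.refFS a) t)
        { S with fs := Function.update S.fs a (some (l, l', t)) } (.un .ret .unit)
  | writeRefFSFail {S a l l' t' t} : S.fs a = some (l, l', t') → ¬ S.cur ≤ l ⊔ l' →
      Act S (.bin (.writeRef .fs) (.refFS a) t) S (.un .unlabel (.lb l .diverge))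
  | labelOfFS {S a l l' t} : S.fs a = some (l, l', t) →
      Act S (.un (.labelOfRef .fs) (.refFS a)) S (.un .unlabel (.lb l (.lbl l')))
  | upgrade {S a l l' l'' t} : S.fs a = some (l, l'', t) → S.cur ≤ l →
      Act S (.bin .upgrade (.refFS a) (.lbl l'))
        { S with fs := Function.update S.fs a (some (l, l'' ⊔ l', t)) } (.un .ret .unit)
  | downgrade {S a l l' l'' t} : S.fs a = some (l, l'', t) → S.cur ≤ l →
      Act S (.bin .downgrade (.refFS a) (.lbl l'))
        { S with fs := Function.update S.fs a (some (l, l ⊔ (l'' ⊓ l'), .diverge)) }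
        (.un .ret .unit)

/-- Big-step evaluation of a configuration to a value. -/
inductive Eval : Env L → Term L → Env L → Term L → Prop
  | val {S v} : v.IsValue → Eval S v S v
  | pure {S t t' S' v} : PureStep t t' → Eval S t' S' v → Eval S t S' v
  | act {S t S₁ t₁ S' v} : Act S t S₁ t₁ → Eval S₁ t₁ S' v → Eval S t S' v
  | bind {S t u S₁ w S' v} : Eval S t S₁ (.lio w) → Eval S₁ (.bin .app u w) S' v →
      Eval S (.bin .bind t u) S' v
  | toLabeled {S k t S₁ w S' v} : S.cur ≤ k → Eval S t S₁ (.lio w) → S₁.cur ≤ k →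
      Eval { S₁ with cur := S.cur } (.bin .label (.lbl k) w) S' v →
      Eval S (.bin .toLabeled (.lbl k) t) S' v

theorem PureStep.not_isValue {t t' : Term L} (h : PureStep t t') : ¬ t.IsValue := by
  cases h <;> intro h <;> cases h

theorem Act.not_isValue {S S' : Env L} {t t' : Term L} (h : Act S t S' t') : ¬ t.IsValue := by
  cases h <;> intro h <;> cases h

theorem PureStep.not_act {t t' : Term L} (hp : PureStep t t') {S S' : Env L} {u : Term L} :
    ¬ Act S t S' u := by
  intro ha
  cases ha <;> cases hp <;>
    first
    | (rename_i hs hp'; exact hp'.not_isValue (by constructor))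
    | (rename_i hs _ _; exact hs)
    | (rename_i hs _; exact hs)

theorem not_pureStep_bind {t u w : Term L} : ¬ PureStep (.bin .bind t u) w := by
  intro h
  cases h with
  | leftCtx hs _ => exact hs
  | rightCtx hs _ _ => exact hs

theorem not_pureStep_toLabeled {k : L} {u w : Term L} :
    ¬ PureStep (.bin .toLabeled (.lbl k) u) w := by
  intro h
  cases h with
  | leftCtx hs h => exact h.not_isValue (.lbl _)
  | rightCtx hs _ _ => exact hs

theorem Eval.of_isValue {S S' : Env L} {t v : Term L} (h : Eval S t S' v) (ht : t.IsValue) :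
    S' = S ∧ v = t := by
  cases h with
  | val _ => exact ⟨rfl, rfl⟩
  | pure hp _ => exact absurd ht hp.not_isValue
  | act ha _ => exact absurd ht ha.not_isValue
  | bind _ _ => cases ht
  | toLabeled _ _ _ _ => cases ht

theorem Eval.bind_inv {S S' : Env L} {t u v : Term L} (h : Eval S (.bin .bind t u) S' v) :
    ∃ S₁ w, Eval S t S₁ (.lio w) ∧ Eval S₁ (.bin .app u w) S' v := by
  cases h with
  | val h => cases h
  | pure hp _ => exact absurd hp not_pureStep_bind
  | act ha _ => cases ha
  | bind h₁ h₂ => exact ⟨_, _, h₁, h₂⟩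

theorem Eval.toLabeled_inv {S S' : Env L} {k : L} {t v : Term L}
    (h : Eval S (.bin .toLabeled (.lbl k) t) S' v) :
    ∃ S₁ w, Eval S t S₁ (.lio w) ∧ S₁.cur ≤ k ∧
      Eval { S₁ with cur := S.cur } (.bin .label (.lbl k) w) S' v := by
  cases h with
  | val h => cases h
  | pure hp _ => exact absurd hp not_pureStep_toLabeled
  | act ha _ => cases ha
  | toLabeled _ h₁ h₂ h₃ => exact ⟨_, _, h₁, h₂, h₃⟩

theorem Eval.ret_inv {S S' : Env L} {t v : Term L} (h : Eval S (.un .ret t) S' v) :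
    S' = S ∧ v = .lio t := by
  cases h with
  | val h => cases h
  | pure hp _ => exact absurd Act.ret (hp.not_act (S := S))
  | act ha h => cases ha; exact h.of_isValue (.lio _)

theorem Eval.label_inv {S S' : Env L} {k : L} {t v : Term L}
    (h : Eval S (.bin .label (.lbl k) t) S' v) : S' = S ∧ v = .lio (.lb k t) := by
  cases h with
  | val h => cases h
  | pure hp _ =>
    cases hp with
    | leftCtx _ hp => exact absurd (.lbl _) hp.not_isValue
    | rightCtx hs _ _ => exact hs.elim
  | act ha h => cases ha; exact h.ret_inv

theorem Eval.app_lam_inv {S S' : Env L} {t u v : Term L}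
    (h : Eval S (.bin .app (.lam t) u) S' v) : Eval S (t.inst u) S' v := by
  cases h with
  | val h => cases h
  | pure hp h =>
    cases hp with
    | app => exact h
    | leftCtx _ hp => exact absurd (.lam _) hp.not_isValue
    | rightCtx hs _ _ => exact hs.elim
  | act ha _ => cases ha

theorem Eval.upgradeStore_inv {S S' : Env L} {k : L} {v : Term L}
    (h : Eval S (.upgradeStore k) S' v) :
    S.Upgradable ∧ S' = { S with fs := S.upgraded k } := by
  cases h with
  | val h => cases h
  | pure hp _ => cases hp
  | act ha h =>
    cases ha with
    | upgradeStore hu => exact ⟨hu, (h.of_isValue (.lio _)).1⟩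

theorem Eval.upgrade_inv {S S' : Env L} {k : L} {a : Addr} {v : Term L}
    (h : Eval S (.bin .upgrade (.refFS a) (.lbl k)) S' v) :
    ∃ lo ld t, S.fs a = some (lo, ld, t) ∧ S.cur ≤ lo ∧
      S' = { S with fs := Function.update S.fs a (some (lo, ld ⊔ k, t)) } ∧ v = .lio .unit := by
  cases h with
  | val h => cases h
  | pure hp _ =>
    cases hp with
    | leftCtx _ h => exact absurd (.refFS _) h.not_isValue
    | rightCtx _ _ h => exact absurd (.lbl _) h.not_isValue
  | act ha h =>
    cases ha with
    | upgrade hc hl => exact ⟨_, _, _, hc, hl, h.ret_inv.1, h.ret_inv.2⟩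

theorem Eval.upgradeAll_inv {k : L} {as : List Addr} (hn : as.Nodup) {S S' : Env L} {v : Term L}
    (h : Eval S (Term.upgradeAll k as) S' v) :
    (∀ a ∈ as, ∃ lo ld t, S.fs a = some (lo, ld, t) ∧ S.cur ≤ lo) ∧
      S' = { S with fs := fun a => if a ∈ as then S.upgraded k a else S.fs a } ∧
      v = .lio .unit := by
  induction as generalizing S with
  | nil =>
    obtain ⟨rfl, rfl⟩ := h.ret_inv
    simp
  | cons a as ih =>
    have key : ∀ S₁ : Env L, ∀ lo ld t, S.fs a = some (lo, ld, t) → S.cur ≤ lo →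
        S₁ = { S with fs := Function.update S.fs a (some (lo, ld ⊔ k, t)) } →
        (∀ b ∈ as, ∃ lo ld t, S₁.fs b = some (lo, ld, t) ∧ S₁.cur ≤ lo) →
        S' = { S₁ with fs := fun a => if a ∈ as then S₁.upgraded k a else S₁.fs a } →
        (∀ b ∈ a :: as, ∃ lo ld t, S.fs b = some (lo, ld, t) ∧ S.cur ≤ lo) ∧
        S' = { S with fs := fun b => if b ∈ a :: as then S.upgraded k b else S.fs b } := by
      rintro _ lo ld t hc hl rfl hall rfl
      rw [List.nodup_cons] at hn
      refine ⟨fun b hb => ?_, ?_⟩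
      · rcases List.mem_cons.1 hb with rfl | hb
        · exact ⟨_, _, _, hc, hl⟩
        · obtain ⟨lo', ld', t', h₁, h₂⟩ := hall b hb
          have : b ≠ a := fun e => hn.1 (e ▸ hb)
          exact ⟨lo', ld', t', by simpa [this] using h₁, h₂⟩
      · congr 1
        funext b
        by_cases hba : b = a
        · subst hba; simp [hn.1, Env.upgraded, hc]
        · simp [hba, Env.upgraded]
    cases as with
    | nil =>
      obtain ⟨lo, ld, t, hc, hl, rfl, rfl⟩ := h.upgrade_inv
      obtain ⟨h₁, h₂⟩ := key _ lo ld t hc hl rfl (by simp) (by simp)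
      exact ⟨h₁, h₂, rfl⟩
    | cons b as =>
      obtain ⟨S₁, w, h₁, h₂⟩ := Eval.bind_inv h
      obtain ⟨lo, ld, t, hc, hl, hS, hw⟩ := h₁.upgrade_inv
      have h₃ := h₂.app_lam_inv
      rw [Term.inst, Term.sub_upgradeAll] at h₃
      obtain ⟨g₁, g₂, g₃⟩ := ih (List.nodup_cons.1 hn).2 h₃
      obtain ⟨h₁, h₂⟩ := key _ lo ld t hc hl hS g₁ g₂
      exact ⟨h₁, h₂, g₃⟩

mutual

theorem Step.eval {S S₁ : Env L} {t t₁ : Term L} :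
    Step S t S₁ t₁ → ∀ {S' v}, Eval S₁ t₁ S' v → Eval S t S' v
  | .pure hp, _, _, h => .pure hp h
  | .bindCtx hs, _, _, h =>
    let ⟨_, _, h₁, h₂⟩ := h.bind_inv
    .bind (Step.eval hs h₁) h₂
  | .ret, _, _, h => .act .ret h
  | .bind, _, _, h => .bind (.val (.lio _)) h
  | .getLabel, _, _, h => .act .getLabel h
  | .label hl, _, _, h => .act (.label hl) h
  | .unlabel hs, _, _, h => by
    obtain ⟨hu, he⟩ := (Steps.eval hs (.lio _)).upgradeStore_inv
    have hμ := congrArg Env.fs he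
    dsimp only at hμ
    subst hμ
    exact .act (.unlabel hu) h
  | @Step.upgradeStore _ _ S k as hn hm, _, _, h => by
    obtain ⟨h₁, rfl, rfl⟩ := Eval.upgradeAll_inv hn h
    have hu : S.Upgradable := by
      intro a lo ld t hc
      obtain ⟨_, _, _, hc', hl⟩ := h₁ a ((hm a).2 (by simp [hc]))
      rw [hc] at hc'
      cases hc'
      exact hl
    have : (fun a => if a ∈ as then S.upgraded k a else S.fs a) = S.upgraded k := by
      funext a
      by_cases ha : a ∈ as
      · simp [ha]
      · have : S.fs a = none := by simpa using fun h => ha ((hm a).2 h)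
        simp [ha, Env.upgraded, this]
    rw [this]
    exact .act (.upgradeStore hu) (.val (.lio _))
  | .toLabeled h₁ hs h₂, _, _, h => .toLabeled h₁ (Steps.eval hs (.lio _)) h₂ h
  | .newRefFI h₁ h₂, _, _, h => .act (.newRefFI h₁ h₂) h
  | .readRefFI h₁, _, _, h => .act (.readRefFI h₁) h
  | .writeRefFI h₁, _, _, h => .act (.writeRefFI h₁) h
  | .copyRef h₁ h₂ h₃, _, _, h => .act (.copyRef h₁ h₂ h₃) h
  | .newRefFS h₁ h₂, _, _, h => .act (.newRefFS h₁ h₂) h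
  | .readRefFS h₁, _, _, h => .act (.readRefFS h₁) h
  | .writeRefFS h₁ h₂, _, _, h => .act (.writeRefFS h₁ h₂) h
  | .writeRefFSFail h₁ h₂, _, _, h => .act (.writeRefFSFail h₁ h₂) h
  | .labelOfFS h₁, _, _, h => .act (.labelOfFS h₁) h
  | .upgrade h₁ h₂, _, _, h => .act (.upgrade h₁ h₂) h
  | .downgrade h₁ h₂, _, _, h => .act (.downgrade h₁ h₂) h

/-- A reduction sequence that ends in a value is a big-step evaluation. -/
theorem Steps.eval {S S' : Env L} {t v : Term L} : Steps S t S' v → v.IsValue → Eval S t S' v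
  | .refl, hv => .val hv
  | .head hs h, hv => Step.eval hs (Steps.eval h hv)

end

end BigStep

end FlowSens

namespace FlowSens

variable {L : Type*}

namespace Env

/-- Every reference in the term is allocated in `S` outside of `A`, and flow-insensitive references
carry the label of their cell. -/
def SafeRefs (A : Set Addr) (S : Env L) : Term L → Prop
  | .refFI l a => a ∉ A ∧ ∃ t, S.fi a = some (l, t)
  | .refFS a => a ∉ A ∧ ∃ c, S.fs a = some c
  | .lam t => SafeRefs A S t
  | .lio t => SafeRefs A S t
  | .lb _ t => SafeRefs A S t
  | .un _ t => SafeRefs A S t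
  | .bin _ t u => SafeRefs A S t ∧ SafeRefs A S u
  | .ite t u w => SafeRefs A S t ∧ SafeRefs A S u ∧ SafeRefs A S w
  | _ => True

/-- `S'` has at least the cells of `S`, with the same flow-insensitive labels. -/
structure Extends (S S' : Env L) : Prop where
  fi : ∀ a k t, S.fi a = some (k, t) → ∃ t', S'.fi a = some (k, t')
  fs : ∀ a c, S.fs a = some c → ∃ c', S'.fs a = some c'

/-- `S` arises from `S₀` by a run that has no access to the cells of `S₀`: these have only been
upgraded, and the remaining cells do not refer to them. -/
structure Unreached (S₀ S : Env L) : Prop where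
  fi_init : ∀ a ∈ S₀.dom, S.fi a = S₀.fi a
  fs_init : ∀ a ∈ S₀.dom,
    (S.fs a).map (fun c => (c.1, c.2.2)) = (S₀.fs a).map fun c => (c.1, c.2.2)
  fi_safe : ∀ a k t, a ∉ S₀.dom → S.fi a = some (k, t) → SafeRefs S₀.dom S t
  fs_safe : ∀ a lo ld t, a ∉ S₀.dom → S.fs a = some (lo, ld, t) → SafeRefs S₀.dom S t

theorem Extends.refl (S : Env L) : Extends S S := ⟨fun _ _ t h => ⟨t, h⟩, fun _ c h => ⟨c, h⟩⟩

theorem Extends.trans {S S' S'' : Env L} (h : Extends S S') (h' : Extends S' S'') :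
    Extends S S'' where
  fi a k t hc := let ⟨_, hc⟩ := h.fi a k t hc; h'.fi a k _ hc
  fs a c hc := let ⟨_, hc⟩ := h.fs a c hc; h'.fs a _ hc

theorem Extends.safeRefs {A : Set Addr} {S S' : Env L} (h : Extends S S') {t : Term L}
    (ht : SafeRefs A S t) : SafeRefs A S' t := by
  induction t with
  | refFI l a => exact ⟨ht.1, let ⟨_, h₂⟩ := ht.2; h.fi _ _ _ h₂⟩
  | refFS a => exact ⟨ht.1, let ⟨_, h₂⟩ := ht.2; h.fs _ _ h₂⟩
  | lam t ih | lio t ih | lb l t ih | un o t ih => exact ih ht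
  | bin o t u iht ihu => exact ⟨iht ht.1, ihu ht.2⟩
  | ite t u w iht ihu ihw => exact ⟨iht ht.1, ihu ht.2.1, ihw ht.2.2⟩
  | _ => trivial

theorem Unreached.dom_subset {S₀ S : Env L} (h : Unreached S₀ S) : S₀.dom ⊆ S.dom := by
  intro a ha
  rcases ha with hc | hc
  · exact .inl (by rw [h.fi_init a (.inl hc)]; exact hc)
  · refine .inr fun e => hc ?_
    simpa [e, eq_comm] using h.fs_init a (.inr hc)

theorem SafeRefs.of_noTCB {A : Set Addr} {S : Env L} {t : Term L} (h : t.NoTCBExceptLb) :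
    SafeRefs A S t := by
  induction t with
  | lam t ih | lb l t ih | un o t ih => exact ih h
  | bin o t u iht ihu => exact ⟨iht h.1, ihu h.2⟩
  | ite t u w iht ihu ihw => exact ⟨iht h.1, ihu h.2.1, ihw h.2.2⟩
  | lio t | refFI l a | refFS a => exact h.elim
  | _ => trivial

theorem SafeRefs.ren {A : Set Addr} {S : Env L} {t : Term L} (h : SafeRefs A S t) (ξ : ℕ → ℕ) :
    SafeRefs A S (t.ren ξ) := by
  induction t generalizing ξ with
  | lam t ih | lio t ih | lb l t ih | un o t ih => exact ih h _
  | bin o t u iht ihu => exact ⟨iht h.1 _, ihu h.2 _⟩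
  | ite t u w iht ihu ihw => exact ⟨iht h.1 _, ihu h.2.1 _, ihw h.2.2 _⟩
  | refFI l a | refFS a => exact h
  | _ => trivial

theorem SafeRefs.sub {A : Set Addr} {S : Env L} {t : Term L} (h : SafeRefs A S t)
    {σ : ℕ → Term L} (hσ : ∀ n, SafeRefs A S (σ n)) : SafeRefs A S (t.sub σ) := by
  induction t generalizing σ with
  | var n => exact hσ n
  | lam t ih =>
    refine ih (σ := Term.liftSub σ) h fun n => ?_
    cases n with
    | zero => trivial
    | succ n => exact (hσ n).ren _
  | lio t ih | lb l t ih | un o t ih => exact ih h hσ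
  | bin o t u iht ihu => exact ⟨iht h.1 hσ, ihu h.2 hσ⟩
  | ite t u w iht ihu ihw => exact ⟨iht h.1 hσ, ihu h.2.1 hσ, ihw h.2.2 hσ⟩
  | refFI l a | refFS a => exact h
  | _ => trivial

theorem SafeRefs.inst {A : Set Addr} {S : Env L} {t u : Term L} (ht : SafeRefs A S t)
    (hu : SafeRefs A S u) : SafeRefs A S (t.inst u) := by
  refine ht.sub fun n => ?_
  cases n with
  | zero => exact hu
  | succ n => trivial

theorem SafeRefs.pureStep [Lattice L] {A : Set Addr} {S : Env L} {t t' : Term L}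
    (h : SafeRefs A S t) (hp : PureStep t t') : SafeRefs A S t' := by
  induction hp with
  | app => exact SafeRefs.inst h.1 h.2
  | fix => exact SafeRefs.inst (t := _) h h
  | ifTrue => exact h.2.1
  | ifFalse => exact h.2.2
  | unCtx _ _ ih => exact ih h
  | leftCtx _ _ ih => exact ⟨ih h.1, h.2⟩
  | rightCtx _ _ _ ih => exact ⟨h.1, ih h.2⟩
  | iteCtx _ ih => exact ⟨ih h.1, h.2⟩
  | _ => trivial

theorem Unreached.refl {S : Env L} : Unreached S S where
  fi_init _ _ := rfl
  fs_init _ _ := rfl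
  fi_safe a k t ha hc := (ha (.inl (by simp [hc]))).elim
  fs_safe a lo ld t ha hc := (ha (.inr (by simp [hc]))).elim

theorem Extends.setCur {S S' : Env L} (h : Extends S S') (k : L) :
    Extends S { S' with cur := k } := ⟨h.fi, h.fs⟩

theorem Unreached.setCur {S₀ S : Env L} (h : Unreached S₀ S) (k : L) :
    Unreached S₀ { S with cur := k } where
  fi_init := h.fi_init
  fs_init := h.fs_init
  fi_safe a k' t ha hc := ((Extends.refl S).setCur k).safeRefs (h.fi_safe a k' t ha hc)
  fs_safe a lo ld t ha hc := ((Extends.refl S).setCur k).safeRefs (h.fs_safe a lo ld t ha hc)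

theorem Extends.updateFI {S : Env L} {a : Addr} {k : L} {t : Term L}
    (ha : S.fi a = none ∨ ∃ u, S.fi a = some (k, u)) :
    Extends S { S with fi := Function.update S.fi a (some (k, t)) } where
  fi b k' t' hb := by
    by_cases hba : b = a
    · subst hba
      rcases ha with ha | ⟨u, ha⟩ <;> rw [hb] at ha <;> cases ha
      exact ⟨t, by simp⟩
    · exact ⟨t', by simpa [hba] using hb⟩
  fs b c hb := ⟨c, hb⟩

theorem Extends.updateFS {S : Env L} {a : Addr} {c : L × L × Term L} :
    Extends S { S with fs := Function.update S.fs a (some c) } where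
  fi b k' t' hb := ⟨t', hb⟩
  fs b d hb := by
    by_cases hba : b = a
    · subst hba; exact ⟨c, by simp⟩
    · exact ⟨d, by simpa [hba] using hb⟩

theorem Unreached.updateFI {S₀ S : Env L} (h : Unreached S₀ S) {a : Addr} {k : L} {t : Term L}
    (ha : S.fi a = none ∨ ∃ u, S.fi a = some (k, u)) (hd : a ∉ S₀.dom)
    (ht : SafeRefs S₀.dom S t) :
    Unreached S₀ { S with fi := Function.update S.fi a (some (k, t)) } where
  fi_init b hb := by
    have : b ≠ a := fun e => hd (e ▸ hb)
    simpa [this] using h.fi_init b hb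
  fs_init := h.fs_init
  fi_safe b k' t' hb hc := by
    refine (Extends.updateFI ha).safeRefs ?_
    by_cases hba : b = a
    · subst hba
      simp only [Function.update_self] at hc
      cases hc
      exact ht
    · exact h.fi_safe b k' t' hb (by simpa [hba] using hc)
  fs_safe b lo ld t' hb hc := (Extends.updateFI ha).safeRefs (h.fs_safe b lo ld t' hb hc)

theorem Unreached.updateFS {S₀ S : Env L} (h : Unreached S₀ S) {a : Addr} {lo ld : L} {t : Term L}
    (hd : a ∉ S₀.dom) (ht : SafeRefs S₀.dom S t) :
    Unreached S₀ { S with fs := Function.update S.fs a (some (lo, ld, t)) } where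
  fi_init := h.fi_init
  fs_init b hb := by
    have : b ≠ a := fun e => hd (e ▸ hb)
    simpa [this] using h.fs_init b hb
  fi_safe b k' t' hb hc := Extends.updateFS.safeRefs (h.fi_safe b k' t' hb hc)
  fs_safe b lo' ld' t' hb hc := by
    refine Extends.updateFS.safeRefs ?_
    by_cases hba : b = a
    · subst hba
      simp only [Function.update_self] at hc
      cases hc
      exact ht
    · exact h.fs_safe b lo' ld' t' hb (by simpa [hba] using hc)

theorem upgraded_eq_some [Lattice L] {S : Env L} {k : L} {a : Addr} {lo ld : L} {t : Term L} :
    S.upgraded k a = some (lo, ld, t) ↔ ∃ ld', S.fs a = some (lo, ld', t) ∧ ld' ⊔ k = ld := by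
  simp only [upgraded, Option.map_eq_some_iff]
  constructor
  · rintro ⟨⟨_, ld', _⟩, h, he⟩
    cases he
    exact ⟨ld', h, rfl⟩
  · rintro ⟨ld', h, rfl⟩
    exact ⟨_, h, rfl⟩

theorem Extends.upgrade [Lattice L] (S : Env L) (k : L) :
    Extends S { S with fs := S.upgraded k } where
  fi a k t h := ⟨t, h⟩
  fs a c h := ⟨_, by simp only [upgraded, h]; rfl⟩

theorem Unreached.upgrade [Lattice L] {S₀ S : Env L} (h : Unreached S₀ S) (k : L) :
    Unreached S₀ { S with fs := S.upgraded k } where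
  fi_init := h.fi_init
  fs_init a ha := by
    rw [← h.fs_init a ha]
    simp [upgraded, Function.comp_def]
  fi_safe a k' t ha hc := (Extends.upgrade S k).safeRefs (h.fi_safe a k' t ha hc)
  fs_safe a lo ld t ha hc := by
    obtain ⟨ld', hc, -⟩ := upgraded_eq_some.1 hc
    exact (Extends.upgrade S k).safeRefs (h.fs_safe a lo ld' t ha hc)

end Env

open Env

theorem fi_eq_none_of_notMem_dom {S : Env L} {a : Addr} (h : a ∉ S.dom) : S.fi a = none := by
  by_contra hc; exact h (.inl hc)

theorem fs_eq_none_of_notMem_dom {S : Env L} {a : Addr} (h : a ∉ S.dom) : S.fs a = none := by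
  by_contra hc; exact h (.inr hc)

variable [Lattice L]

theorem Act.safe {S₀ S S' : Env L} {t t' : Term L} (h : Act S t S' t') (hS : Unreached S₀ S)
    (ht : SafeRefs S₀.dom S t) :
    Unreached S₀ S' ∧ Extends S S' ∧ SafeRefs S₀.dom S' t' := by
  cases h with
  | ret => exact ⟨hS, .refl _, ht⟩
  | getLabel => exact ⟨hS, .refl _, trivial⟩
  | label _ => exact ⟨hS, .refl _, ht.2⟩
  | @unlabel k _ _ =>
    have he := (Extends.upgrade S (S.cur ⊔ k)).setCur (S.cur ⊔ k)
    exact ⟨(hS.upgrade _).setCur _, he, he.safeRefs (t := _) ht⟩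
  | upgradeStore _ => exact ⟨hS.upgrade _, .upgrade _ _, trivial⟩
  | newRefFI _ ha =>
    have hn := fi_eq_none_of_notMem_dom ha
    have hd := fun h => ha (hS.dom_subset h)
    exact ⟨hS.updateFI (.inl hn) hd ht.2, .updateFI (.inl hn), hd, _, by simp; rfl⟩
  | readRefFI hc =>
    have hs := hS.fi_safe _ _ _ ht.1 hc
    exact ⟨hS, .refl _, hs⟩
  | writeRefFI _ =>
    exact ⟨hS.updateFI (.inr ht.1.2) ht.1.1 ht.2, .updateFI (.inr ht.1.2), trivial⟩
  | copyRef _ _ hc =>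
    exact ⟨hS.updateFI (.inr ht.2.2) ht.2.1 (hS.fi_safe _ _ _ ht.1.1 hc),
      .updateFI (.inr ht.2.2), trivial⟩
  | newRefFS _ ha =>
    have hd := fun h => ha (hS.dom_subset h)
    exact ⟨hS.updateFS hd ht.2, .updateFS, hd, _, by simp; rfl⟩
  | readRefFS hc =>
    have hs := hS.fs_safe _ _ _ _ ht.1 hc
    exact ⟨hS, .refl _, hs⟩
  | writeRefFS _ _ => exact ⟨hS.updateFS ht.1.1 ht.2, .updateFS, trivial⟩
  | writeRefFSFail _ _ => exact ⟨hS, .refl _, trivial⟩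
  | labelOfFS _ => exact ⟨hS, .refl _, trivial⟩
  | upgrade hc _ => exact ⟨hS.updateFS ht.1.1 (hS.fs_safe _ _ _ _ ht.1.1 hc), .updateFS, trivial⟩
  | downgrade _ _ => exact ⟨hS.updateFS ht.1.1 trivial, .updateFS, trivial⟩

theorem Eval.safe {S₀ S S' : Env L} {t v : Term L} (h : Eval S t S' v) (hS : Unreached S₀ S)
    (ht : SafeRefs S₀.dom S t) :
    Unreached S₀ S' ∧ Extends S S' ∧ SafeRefs S₀.dom S' v := by
  induction h with
  | val _ => exact ⟨hS, .refl _, ht⟩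
  | pure hp _ ih => exact ih hS (ht.pureStep hp)
  | act ha _ ih =>
    obtain ⟨h₁, h₂, h₃⟩ := ha.safe hS ht
    obtain ⟨g₁, g₂, g₃⟩ := ih h₁ h₃
    exact ⟨g₁, h₂.trans g₂, g₃⟩
  | bind _ _ ih₁ ih₂ =>
    obtain ⟨h₁, h₂, h₃⟩ := ih₁ hS ht.1
    obtain ⟨g₁, g₂, g₃⟩ := ih₂ h₁ ⟨h₂.safeRefs ht.2, h₃⟩
    exact ⟨g₁, h₂.trans g₂, g₃⟩
  | @toLabeled S _ _ S₁ _ _ _ _ _ _ _ ih₁ ih₂ =>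
    obtain ⟨h₁, h₂, h₃⟩ := ih₁ hS ht.2
    obtain ⟨g₁, g₂, g₃⟩ := ih₂ (h₁.setCur _)
      ⟨trivial, ((Extends.refl S₁).setCur S.cur).safeRefs (t := _) h₃⟩
    exact ⟨g₁, (h₂.setCur _).trans g₂, g₃⟩

/-- The change from `S` to `S'` is invisible at level `l`. -/
structure InvisibleChange (l : L) (S S' : Env L) : Prop where
  fi : ∀ a k t, S.fi a = some (k, t) → ∃ t', S'.fi a = some (k, t') ∧ (k ≤ l → t' = t)
  fs : ∀ a lo ld t, S.fs a = some (lo, ld, t) →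
    ∃ ld' t', S'.fs a = some (lo, ld', t') ∧ (lo ≤ l → ld' = ld ∧ (ld ≤ l → t' = t))
  fi_new : ∀ a k t, S.fi a = none → S'.fi a = some (k, t) → ¬ k ≤ l ∧ a ∉ S.dom
  fs_new : ∀ a lo ld t, S.fs a = none → S'.fs a = some (lo, ld, t) → ¬ lo ≤ l ∧ a ∉ S.dom

namespace InvisibleChange

variable {l : L}

theorem refl (S : Env L) : InvisibleChange l S S where
  fi _ _ t h := ⟨t, h, fun _ => rfl⟩
  fs _ _ ld t h := ⟨ld, t, h, fun _ => ⟨rfl, fun _ => rfl⟩⟩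
  fi_new _ _ _ h h' := by simp [h] at h'
  fs_new _ _ _ _ h h' := by simp [h] at h'

theorem dom_subset {S S' : Env L} (h : InvisibleChange l S S') : S.dom ⊆ S'.dom := by
  rintro a (ha | ha)
  · obtain ⟨⟨k, t⟩, hc⟩ := Option.ne_none_iff_exists'.1 ha
    obtain ⟨t', hc', -⟩ := h.fi a k t hc
    exact .inl (by simp [hc'])
  · obtain ⟨⟨lo, ld, t⟩, hc⟩ := Option.ne_none_iff_exists'.1 ha
    obtain ⟨ld', t', hc', -⟩ := h.fs a lo ld t hc
    exact .inr (by simp [hc'])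

theorem trans {S S' S'' : Env L} (h : InvisibleChange l S S') (h' : InvisibleChange l S' S'') :
    InvisibleChange l S S'' where
  fi a k t hc := by
    obtain ⟨t₁, hc₁, e₁⟩ := h.fi a k t hc
    obtain ⟨t₂, hc₂, e₂⟩ := h'.fi a k t₁ hc₁
    exact ⟨t₂, hc₂, fun hk => (e₂ hk).trans (e₁ hk)⟩
  fs a lo ld t hc := by
    obtain ⟨ld₁, t₁, hc₁, e₁⟩ := h.fs a lo ld t hc
    obtain ⟨ld₂, t₂, hc₂, e₂⟩ := h'.fs a lo ld₁ t₁ hc₁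
    refine ⟨ld₂, t₂, hc₂, fun hk => ?_⟩
    obtain ⟨rfl, f₁⟩ := e₁ hk
    obtain ⟨rfl, f₂⟩ := e₂ hk
    exact ⟨rfl, fun hd => (f₂ hd).trans (f₁ hd)⟩
  fi_new a k t hn hc := by
    cases hc' : S'.fi a with
    | none =>
      obtain ⟨h₁, h₂⟩ := h'.fi_new a k t hc' hc
      exact ⟨h₁, fun ha => h₂ (h.dom_subset ha)⟩
    | some c =>
      obtain ⟨k', t'⟩ := c
      obtain ⟨t₂, hc₂, -⟩ := h'.fi a k' t' hc'
      rw [hc] at hc₂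
      cases hc₂
      exact h.fi_new a k t' hn hc'
  fs_new a lo ld t hn hc := by
    cases hc' : S'.fs a with
    | none =>
      obtain ⟨h₁, h₂⟩ := h'.fs_new a lo ld t hc' hc
      exact ⟨h₁, fun ha => h₂ (h.dom_subset ha)⟩
    | some c =>
      obtain ⟨lo', ld', t'⟩ := c
      obtain ⟨ld₂, t₂, hc₂, -⟩ := h'.fs a lo' ld' t' hc'
      rw [hc] at hc₂
      cases hc₂
      exact h.fs_new a lo ld' t' hn hc'

theorem setCur {S S' : Env L} (h : InvisibleChange l S S') (k : L) :
    InvisibleChange l S { S' with cur := k } := ⟨h.fi, h.fs, h.fi_new, h.fs_new⟩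

theorem updateFI {S : Env L} {a : Addr} {k : L} {t : Term L} (hk : ¬ k ≤ l)
    (ha : a ∉ S.dom ∨ ∃ u, S.fi a = some (k, u)) :
    InvisibleChange l S { S with fi := Function.update S.fi a (some (k, t)) } where
  fi b k' t' hb := by
    by_cases hba : b = a
    · subst hba
      rcases ha with ha | ⟨u, ha⟩
      · simp [fi_eq_none_of_notMem_dom ha] at hb
      · rw [hb] at ha; cases ha
        exact ⟨t, by simp, fun h => (hk h).elim⟩
    · exact ⟨t', by simpa [hba] using hb, fun _ => rfl⟩
  fs := (refl S).fs
  fi_new b k' t' hn hb := by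
    by_cases hba : b = a
    · subst hba
      simp only [Function.update_self] at hb
      cases hb
      refine ⟨hk, ?_⟩
      rcases ha with ha | ⟨u, ha⟩
      · exact ha
      · simp [ha] at hn
    · simp [hba, hn] at hb
  fs_new := (refl S).fs_new

theorem updateFS {S : Env L} {a : Addr} {lo ld : L} {t : Term L}
    (ha : (a ∉ S.dom ∧ ¬ lo ≤ l) ∨
      ∃ ld' t', S.fs a = some (lo, ld', t') ∧ (lo ≤ l → ld = ld' ∧ ¬ ld' ≤ l)) :
    InvisibleChange l S { S with fs := Function.update S.fs a (some (lo, ld, t)) } where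
  fi := (refl S).fi
  fs b lo₁ ld₁ t₁ hb := by
    by_cases hba : b = a
    · subst hba
      rcases ha with ha | ⟨ld', t', ha, e⟩
      · simp [fs_eq_none_of_notMem_dom ha.1] at hb
      · rw [hb] at ha; cases ha
        exact ⟨ld, t, by simp, fun h => ⟨(e h).1, fun h' => ((e h).2 h').elim⟩⟩
    · exact ⟨ld₁, t₁, by simpa [hba] using hb, fun _ => ⟨rfl, fun _ => rfl⟩⟩
  fi_new := (refl S).fi_new
  fs_new b lo₁ ld₁ t₁ hn hb := by
    by_cases hba : b = a
    · subst hba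
      simp only [Function.update_self] at hb
      cases hb
      rcases ha with ha | ⟨ld', t', ha, e⟩
      · exact ⟨ha.2, ha.1⟩
      · simp [ha] at hn
    · simp [hba, hn] at hb

theorem upgrade {S : Env L} (hS : S.Upgradable) (hl : ¬ S.cur ≤ l) (k : L) :
    InvisibleChange l S { S with fs := S.upgraded k } where
  fi := (refl S).fi
  fs a lo ld t hc :=
    ⟨ld ⊔ k, t, upgraded_eq_some.2 ⟨ld, hc, rfl⟩,
      fun h => (hl ((hS a lo ld t hc).trans h)).elim⟩
  fi_new := (refl S).fi_new
  fs_new a lo ld t hn hc := by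
    obtain ⟨ld', hc, -⟩ := upgraded_eq_some.1 hc
    simp [hn] at hc

end InvisibleChange

theorem Act.invisible {l : L} {S₀ S S' : Env L} {t t' : Term L} (h : Act S t S' t')
    (ht : SafeRefs S₀.dom S t) (hl : ¬ S.cur ≤ l) :
    InvisibleChange l S S' ∧ ¬ S'.cur ≤ l := by
  have up : ∀ {k}, S.cur ≤ k → ¬ k ≤ l := fun h h' => hl (h.trans h')
  cases h with
  | unlabel hu => exact ⟨(InvisibleChange.upgrade hu hl _).setCur _, up le_sup_left⟩
  | upgradeStore hu => exact ⟨.upgrade hu hl _, hl⟩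
  | newRefFI h ha => exact ⟨.updateFI (up h) (.inl ha), hl⟩
  | writeRefFI h => exact ⟨.updateFI (up h) (.inr ht.1.2), hl⟩
  | copyRef _ h _ => exact ⟨.updateFI (up h) (.inr ht.2.2), hl⟩
  | newRefFS h ha => exact ⟨.updateFS (.inl ⟨ha, hl⟩), hl⟩
  | writeRefFS hc h =>
    exact ⟨.updateFS (.inr ⟨_, _, hc, fun h₁ => ⟨rfl, fun h₂ => up h (sup_le h₁ h₂)⟩⟩), hl⟩
  | upgrade hc h => exact ⟨.updateFS (.inr ⟨_, _, hc, fun h₁ => (up h h₁).elim⟩), hl⟩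
  | downgrade hc h => exact ⟨.updateFS (.inr ⟨_, _, hc, fun h₁ => (up h h₁).elim⟩), hl⟩
  | _ => exact ⟨.refl _, hl⟩

/-- A run under a current label that is not visible has no visible effect. -/
theorem Eval.invisible {l : L} {S₀ S S' : Env L} {t v : Term L} (h : Eval S t S' v)
    (hS : Unreached S₀ S) (ht : SafeRefs S₀.dom S t) (hl : ¬ S.cur ≤ l) :
    InvisibleChange l S S' ∧ ¬ S'.cur ≤ l := by
  induction h with
  | val _ => exact ⟨.refl _, hl⟩
  | pure hp _ ih => exact ih hS (ht.pureStep hp) hl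
  | act ha _ ih =>
    obtain ⟨h₁, -, h₃⟩ := ha.safe hS ht
    obtain ⟨g₁, g₂⟩ := ha.invisible ht hl
    obtain ⟨f₁, f₂⟩ := ih h₁ h₃ g₂
    exact ⟨g₁.trans f₁, f₂⟩
  | bind h _ ih₁ ih₂ =>
    obtain ⟨h₁, h₂, h₃⟩ := h.safe hS ht.1
    obtain ⟨g₁, g₂⟩ := ih₁ hS ht.1 hl
    obtain ⟨f₁, f₂⟩ := ih₂ h₁ ⟨h₂.safeRefs ht.2, h₃⟩ g₂
    exact ⟨g₁.trans f₁, f₂⟩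
  | @toLabeled S _ _ S₁ _ _ _ _ h _ _ ih₁ ih₂ =>
    obtain ⟨h₁, h₂, h₃⟩ := h.safe hS ht.2
    obtain ⟨g₁, g₂⟩ := ih₁ hS ht.2 hl
    obtain ⟨f₁, f₂⟩ := ih₂ (h₁.setCur _)
      ⟨trivial, ((Extends.refl S₁).setCur S.cur).safeRefs (t := _) h₃⟩ hl
    exact ⟨(g₁.setCur _).trans f₁, f₂⟩

end FlowSens

namespace FlowSens

open Env

variable {L : Type*} [Lattice L]

/-- Similarity of terms at level `l`: the terms agree up to the contents of invisible labeled
values, and up to the relation `P` between the addresses. -/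
inductive Similar (l : L) (P : Addr → Addr → Prop) : Term L → Term L → Prop
  | var {n} : Similar l P (.var n) (.var n)
  | tt : Similar l P .tt .tt
  | ff : Similar l P .ff .ff
  | unit : Similar l P .unit .unit
  | lbl {k} : Similar l P (.lbl k) (.lbl k)
  | lam {t u} : Similar l P t u → Similar l P (.lam t) (.lam u)
  | lio {t u} : Similar l P t u → Similar l P (.lio t) (.lio u)
  | lb {k t u} : (k ≤ l → Similar l P t u) → Similar l P (.lb k t) (.lb k u)
  | refFI {k a b} : P a b → Similar l P (.refFI k a) (.refFI k b)
  | refFS {a b} : P a b → Similar l P (.refFS a) (.refFS b)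
  | diverge : Similar l P .diverge .diverge
  | getLabel : Similar l P .getLabel .getLabel
  | upgradeStore {k} : Similar l P (.upgradeStore k) (.upgradeStore k)
  | un {o t u} : Similar l P t u → Similar l P (.un o t) (.un o u)
  | bin {o t t' u u'} : Similar l P t u → Similar l P t' u' → Similar l P (.bin o t t') (.bin o u u')
  | ite {t t' t'' u u' u''} : Similar l P t u → Similar l P t' u' → Similar l P t'' u'' →
      Similar l P (.ite t t' t'') (.ite u u' u'')

namespace Similar

variable {l : L} {P Q : Addr → Addr → Prop} {t u : Term L}

theorem mono (h : Similar l P t u) (hPQ : ∀ a b, P a b → Q a b) : Similar l Q t u := by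
  induction h with
  | refFI h => exact .refFI (hPQ _ _ h)
  | refFS h => exact .refFS (hPQ _ _ h)
  | _ => constructor <;> assumption

theorem symm (h : Similar l P t u) : Similar l (fun a b => P b a) u t := by
  induction h <;> constructor <;> assumption

theorem isValue (h : Similar l P t u) (ht : t.IsValue) : u.IsValue := by
  cases ht <;> cases h <;> constructor

theorem ren (h : Similar l P t u) (ξ : ℕ → ℕ) : Similar l P (t.ren ξ) (u.ren ξ) := by
  induction h generalizing ξ with
  | lb _ ih => exact .lb fun hk => ih hk ξ
  | refFI h => exact .refFI h
  | refFS h => exact .refFS h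
  | _ => constructor <;> apply_assumption

theorem sub (h : Similar l P t u) {σ τ : ℕ → Term L} (hσ : ∀ n, Similar l P (σ n) (τ n)) :
    Similar l P (t.sub σ) (u.sub τ) := by
  induction h generalizing σ τ with
  | var => exact hσ _
  | lam _ ih =>
    refine .lam (ih fun n => ?_)
    cases n with
    | zero => exact .var
    | succ n => exact (hσ n).ren _
  | lb _ ih => exact .lb fun hk => ih hk hσ
  | refFI h => exact .refFI h
  | refFS h => exact .refFS h
  | lio _ ih => exact .lio (ih hσ)
  | un _ ih => exact .un (ih hσ)
  | bin _ _ ih₁ ih₂ => exact .bin (ih₁ hσ) (ih₂ hσ)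
  | ite _ _ _ ih₁ ih₂ ih₃ => exact .ite (ih₁ hσ) (ih₂ hσ) (ih₃ hσ)
  | _ => constructor

theorem inst {t' u' : Term L} (h : Similar l P t u) (h' : Similar l P t' u') :
    Similar l P (t.inst t') (u.inst u') := by
  refine h.sub fun n => ?_
  cases n with
  | zero => exact h'
  | succ n => exact .var

/-- Similar terms take similar pure steps. -/
theorem pureStep (h : Similar l P t u) {t' : Term L} (hp : PureStep t t') :
    ∃ u', PureStep u u' ∧ Similar l P t' u' := by
  induction hp generalizing u with
  | app =>
    cases h with | bin h₁ h₂ => cases h₁ with | lam h₁ => exact ⟨_, .app, h₁.inst h₂⟩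
  | fix =>
    cases h with | un h => cases h with | lam h => exact ⟨_, .fix, h.inst (.un (.lam h))⟩
  | ifTrue => cases h with | ite h₁ h₂ h₃ => cases h₁; exact ⟨_, .ifTrue, h₂⟩
  | ifFalse => cases h with | ite h₁ h₂ h₃ => cases h₁; exact ⟨_, .ifFalse, h₃⟩
  | join => cases h with | bin h₁ h₂ => cases h₁; cases h₂; exact ⟨_, .join, .lbl⟩
  | meet => cases h with | bin h₁ h₂ => cases h₁; cases h₂; exact ⟨_, .meet, .lbl⟩
  | leTrue hk => cases h with | bin h₁ h₂ => cases h₁; cases h₂; exact ⟨_, .leTrue hk, .tt⟩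
  | leFalse hk => cases h with | bin h₁ h₂ => cases h₁; cases h₂; exact ⟨_, .leFalse hk, .ff⟩
  | labelOf => cases h with | un h => cases h; exact ⟨_, .labelOf, .lbl⟩
  | labelOfFI => cases h with | un h => cases h; exact ⟨_, .labelOfFI, .lbl⟩
  | unCtx ho _ ih =>
    cases h with | un h => obtain ⟨u', h₁, h₂⟩ := ih h; exact ⟨_, .unCtx ho h₁, .un h₂⟩
  | leftCtx ho _ ih =>
    cases h with
    | bin h h' => obtain ⟨u', h₁, h₂⟩ := ih h; exact ⟨_, .leftCtx ho h₁, .bin h₂ h'⟩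
  | rightCtx ho hv _ ih =>
    cases h with
    | bin h h' =>
      obtain ⟨u', h₁, h₂⟩ := ih h'
      exact ⟨_, .rightCtx ho (h.isValue hv) h₁, .bin h h₂⟩
  | iteCtx _ ih =>
    cases h with
    | ite h h' h'' => obtain ⟨u', h₁, h₂⟩ := ih h; exact ⟨_, .iteCtx h₁, .ite h₂ h' h''⟩

theorem of_erase_eq (ht : t.NoTCBExceptLb) (h : t.erase l = u.erase l) : Similar l P t u := by
  induction t generalizing u with
  | lam t ih => cases u <;> simp [Term.erase] at h; exact .lam (ih ht h)
  | lb k t ih =>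
    cases u <;> simp [Term.erase] at h
    obtain ⟨rfl, h⟩ := h
    exact .lb fun hk => ih ht (by simpa [hk] using h)
  | un o t ih => cases u <;> simp [Term.erase] at h; obtain ⟨rfl, h⟩ := h; exact .un (ih ht h)
  | bin o t t' ih ih' =>
    cases u <;> simp [Term.erase] at h
    obtain ⟨rfl, h, h'⟩ := h
    exact .bin (ih ht.1 h) (ih' ht.2 h')
  | ite t t' t'' ih ih' ih'' =>
    cases u <;> simp [Term.erase] at h
    obtain ⟨h, h', h''⟩ := h
    exact .ite (ih ht.1 h) (ih' ht.2.1 h') (ih'' ht.2.2 h'')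
  | lio t | refFI l a | refFS a | bullet => exact ht.elim
  | _ => cases u <;> simp [Term.erase] at h; first | constructor | (subst h; constructor)

theorem mapAddr_erase (h : Similar l P t u) {π : Addr → Addr} (hπ : ∀ a b, P a b → π a = b) :
    (t.erase l).mapAddr π = u.erase l := by
  induction h with
  | refFI h => simp [Term.erase, Term.mapAddr, hπ _ _ h]
  | refFS h => simp [Term.erase, Term.mapAddr, hπ _ _ h]
  | @lb k t u _ ih =>
    by_cases hk : k ≤ l
    · simp [Term.erase, Term.mapAddr, hk, ih hk]
    · simp [Term.erase, Term.mapAddr, hk]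
  | _ => simp_all [Term.erase, Term.mapAddr]

end Similar

theorem PureStep.deterministic {t u u' : Term L} (h : PureStep t u) (h' : PureStep t u') :
    u = u' := by
  induction h generalizing u' with
  | unCtx ho hp ih =>
    cases h' with
    | unCtx _ h' => rw [ih h']
    | _ => exact absurd (by constructor) hp.not_isValue
  | leftCtx ho hp ih =>
    cases h' with
    | leftCtx _ h' => rw [ih h']
    | rightCtx _ hv _ => exact absurd hv hp.not_isValue
    | _ => exact absurd (by constructor) hp.not_isValue
  | rightCtx ho hv hp ih =>
    cases h' with
    | leftCtx _ h' => exact absurd hv h'.not_isValue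
    | rightCtx _ _ h' => rw [ih h']
    | app => exact ho.elim
    | _ => exact absurd (by constructor) hp.not_isValue
  | iteCtx hp ih =>
    cases h' with
    | iteCtx h' => rw [ih h']
    | _ => exact absurd (by constructor) hp.not_isValue
  | app =>
    cases h' with
    | app => rfl
    | leftCtx _ h' => exact absurd (by constructor) h'.not_isValue
    | rightCtx ho _ _ => exact ho.elim
  | _ =>
    cases h' <;> first
      | rfl
      | contradiction

/-- The relation between addresses given by a permutation restricted to a set. -/
def Linked (π : Equiv.Perm Addr) (D : Set Addr) (a b : Addr) : Prop := a ∈ D ∧ π a = b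

/-- Similarity of flow-insensitive cells. -/
def SimilarFI (l : L) (P : Addr → Addr → Prop) (c d : L × Term L) : Prop :=
  c.1 = d.1 ∧ (c.1 ≤ l → Similar l P c.2 d.2)

/-- Similarity of flow-sensitive cells with a visible outer label. -/
def SimilarFS (l : L) (P : Addr → Addr → Prop) (c d : L × L × Term L) : Prop :=
  c.1 ≤ l ∧ c.1 = d.1 ∧ c.2.1 = d.2.1 ∧ (c.2.1 ≤ l → Similar l P c.2.2 d.2.2)

/-- The stores of `S₁` and `S₂` are similar at level `l`; `A` is the set of addresses that were
allocated at the start, `D` the set of addresses of the first run that occur visibly. -/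
structure StoreSimilar (l : L) (A : Set Addr) (π : Equiv.Perm Addr) (D : Set Addr)
    (S₁ S₂ : Env L) : Prop where
  fixed : ∀ a ∈ A, π a = a
  disjoint : ∀ a ∈ D, a ∉ A
  mem_left : ∀ a ∈ D, a ∈ S₁.dom
  mem_right : ∀ a ∈ D, π a ∈ S₂.dom
  fi : ∀ a ∈ D, Option.Rel (SimilarFI l (Linked π D)) (S₁.fi a) (S₂.fi (π a))
  fs : ∀ a ∈ D, Option.Rel (SimilarFS l (Linked π D)) (S₁.fs a) (S₂.fs (π a))
  fi_left : ∀ a k t, a ∉ A → S₁.fi a = some (k, t) → k ≤ l → a ∈ D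
  fs_left : ∀ a lo ld t, a ∉ A → S₁.fs a = some (lo, ld, t) → lo ≤ l → a ∈ D
  fi_right : ∀ a k t, a ∉ A → S₂.fi a = some (k, t) → k ≤ l → π.symm a ∈ D
  fs_right : ∀ a lo ld t, a ∉ A → S₂.fs a = some (lo, ld, t) → lo ≤ l → π.symm a ∈ D
  fs_init : ∀ a ∈ A, ∀ lo ld ld' t t', S₁.fs a = some (lo, ld, t) → S₂.fs a = some (lo, ld', t') →
    lo ≤ l → ld = ld'

namespace StoreSimilar

variable {l : L} {A D : Set Addr} {π : Equiv.Perm Addr} {S₁ S₂ S₁' S₂' : Env L}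

theorem invisible (h : StoreSimilar l A π D S₁ S₂) (h₁ : InvisibleChange l S₁ S₁')
    (h₂ : InvisibleChange l S₂ S₂') :
    StoreSimilar l A π D S₁' S₂' where
  fixed := h.fixed
  disjoint := h.disjoint
  mem_left a ha := h₁.dom_subset (h.mem_left a ha)
  mem_right a ha := h₂.dom_subset (h.mem_right a ha)
  fi a ha := by
    have hr := h.fi a ha
    generalize hc₁ : S₁.fi a = c₁ at hr
    generalize hc₂ : S₂.fi (π a) = c₂ at hr
    cases hr with
    | none =>
      have e₁ : S₁'.fi a = none := by
        by_contra hne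
        obtain ⟨⟨k, t⟩, hc⟩ := Option.ne_none_iff_exists'.1 hne
        exact (h₁.fi_new a k t hc₁ hc).2 (h.mem_left a ha)
      have e₂ : S₂'.fi (π a) = none := by
        by_contra hne
        obtain ⟨⟨k, t⟩, hc⟩ := Option.ne_none_iff_exists'.1 hne
        exact (h₂.fi_new _ k t hc₂ hc).2 (h.mem_right a ha)
      rw [e₁, e₂]
      exact .none
    | @some c d hcd =>
      obtain ⟨k, t⟩ := c
      obtain ⟨k', t'⟩ := d
      obtain ⟨hk, hs⟩ := hcd
      obtain ⟨u, hu, eu⟩ := h₁.fi a k t hc₁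
      obtain ⟨u', hu', eu'⟩ := h₂.fi _ k' t' hc₂
      rw [hu, hu']
      dsimp only at hk hs
      subst hk
      exact .some ⟨rfl, fun hl => by simpa [eu hl, eu' hl] using hs hl⟩
  fs a ha := by
    have hr := h.fs a ha
    generalize hc₁ : S₁.fs a = c₁ at hr
    generalize hc₂ : S₂.fs (π a) = c₂ at hr
    cases hr with
    | none =>
      have e₁ : S₁'.fs a = none := by
        by_contra hne
        obtain ⟨⟨lo, ld, t⟩, hc⟩ := Option.ne_none_iff_exists'.1 hne
        exact (h₁.fs_new a lo ld t hc₁ hc).2 (h.mem_left a ha)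
      have e₂ : S₂'.fs (π a) = none := by
        by_contra hne
        obtain ⟨⟨lo, ld, t⟩, hc⟩ := Option.ne_none_iff_exists'.1 hne
        exact (h₂.fs_new _ lo ld t hc₂ hc).2 (h.mem_right a ha)
      rw [e₁, e₂]
      exact .none
    | @some c d hcd =>
      obtain ⟨lo, ld, t⟩ := c
      obtain ⟨lo', ld', t'⟩ := d
      obtain ⟨hlo, hk, hd, hs⟩ := hcd
      dsimp only at hlo hk hd hs
      subst hk hd
      obtain ⟨m, u, hu, eu⟩ := h₁.fs a lo ld t hc₁
      obtain ⟨m', u', hu', eu'⟩ := h₂.fs _ lo ld t' hc₂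
      obtain ⟨rfl, eu⟩ := eu hlo
      obtain ⟨rfl, eu'⟩ := eu' hlo
      rw [hu, hu']
      exact .some ⟨hlo, rfl, rfl, fun hl => by simpa [eu hl, eu' hl] using hs hl⟩
  fi_left a k t ha hc hk := by
    cases hc₁ : S₁.fi a with
    | none => exact ((h₁.fi_new a k t hc₁ hc).1 hk).elim
    | some c =>
      obtain ⟨k', t'⟩ := c
      obtain ⟨u, hu, -⟩ := h₁.fi a k' t' hc₁
      rw [hc] at hu; cases hu
      exact h.fi_left a k t' ha hc₁ hk
  fs_left a lo ld t ha hc hk := by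
    cases hc₁ : S₁.fs a with
    | none => exact ((h₁.fs_new a lo ld t hc₁ hc).1 hk).elim
    | some c =>
      obtain ⟨lo', ld', t'⟩ := c
      obtain ⟨m, u, hu, -⟩ := h₁.fs a lo' ld' t' hc₁
      rw [hc] at hu; cases hu
      exact h.fs_left a lo ld' t' ha hc₁ hk
  fi_right a k t ha hc hk := by
    cases hc₁ : S₂.fi a with
    | none => exact ((h₂.fi_new a k t hc₁ hc).1 hk).elim
    | some c =>
      obtain ⟨k', t'⟩ := c
      obtain ⟨u, hu, -⟩ := h₂.fi a k' t' hc₁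
      rw [hc] at hu; cases hu
      exact h.fi_right a k t' ha hc₁ hk
  fs_right a lo ld t ha hc hk := by
    cases hc₁ : S₂.fs a with
    | none => exact ((h₂.fs_new a lo ld t hc₁ hc).1 hk).elim
    | some c =>
      obtain ⟨lo', ld', t'⟩ := c
      obtain ⟨m, u, hu, -⟩ := h₂.fs a lo' ld' t' hc₁
      rw [hc] at hu; cases hu
      exact h.fs_right a lo ld' t' ha hc₁ hk
  fs_init a ha lo ld ld' t t' hc hc' hk := by
    cases hc₁ : S₁.fs a with
    | none => exact ((h₁.fs_new a lo ld t hc₁ hc).1 hk).elim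
    | some c =>
      cases hc₂ : S₂.fs a with
      | none => exact ((h₂.fs_new a lo ld' t' hc₂ hc').1 hk).elim
      | some d =>
        obtain ⟨lo₁, ld₁, t₁⟩ := c
        obtain ⟨lo₂, ld₂, t₂⟩ := d
        obtain ⟨m, u, hu, e₁⟩ := h₁.fs a lo₁ ld₁ t₁ hc₁
        obtain ⟨m', u', hu', e₂⟩ := h₂.fs a lo₂ ld₂ t₂ hc₂
        rw [hc] at hu; cases hu
        rw [hc'] at hu'; cases hu'
        rw [(e₁ hk).1, (e₂ hk).1]
        exact h.fs_init a ha lo ld₁ ld₂ t₁ t₂ hc₁ hc₂ hk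

theorem setCur (h : StoreSimilar l A π D S₁ S₂) (k k' : L) :
    StoreSimilar l A π D { S₁ with cur := k } { S₂ with cur := k' } :=
  ⟨h.fixed, h.disjoint, h.mem_left, h.mem_right, h.fi, h.fs, h.fi_left, h.fs_left, h.fi_right,
    h.fs_right, h.fs_init⟩

theorem updateFI (h : StoreSimilar l A π D S₁ S₂) {a b : Addr} (hab : Linked π D a b) {k : L}
    {t u : Term L} (htu : k ≤ l → Similar l (Linked π D) t u) :
    StoreSimilar l A π D { S₁ with fi := Function.update S₁.fi a (some (k, t)) }
      { S₂ with fi := Function.update S₂.fi b (some (k, u)) } := by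
  obtain ⟨ha, rfl⟩ := hab
  have hb : π a ∉ A := fun hA => h.disjoint a ha (by
    have := π.injective (h.fixed _ hA); rwa [this] at hA)
  refine ⟨h.fixed, h.disjoint, fun c hc => ?_, fun c hc => ?_, fun c hc => ?_, h.fs,
    fun c k' t' hA hc hk => ?_, h.fs_left, fun c k' t' hA hc hk => ?_, h.fs_right, h.fs_init⟩
  · by_cases hca : c = a
    · subst hca; exact .inl (by simp)
    · simpa [dom, hca] using h.mem_left c hc
  · by_cases hca : c = a
    · subst hca; exact .inl (by simp)
    · simpa [dom, hca] using h.mem_right c hc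
  · by_cases hca : c = a
    · subst hca; simp only [Function.update_self]; exact .some ⟨rfl, htu⟩
    · simpa [hca] using h.fi c hc
  · by_cases hca : c = a
    · subst hca; exact ha
    · exact h.fi_left c k' t' hA (by simpa [hca] using hc) hk
  · by_cases hca : c = π a
    · subst hca; simpa using ha
    · exact h.fi_right c k' t' hA (by simpa [hca] using hc) hk

theorem updateFS (h : StoreSimilar l A π D S₁ S₂) {a b : Addr} (hab : Linked π D a b) {lo ld : L}
    {t u : Term L} (hlo : lo ≤ l) (htu : ld ≤ l → Similar l (Linked π D) t u) :
    StoreSimilar l A π D { S₁ with fs := Function.update S₁.fs a (some (lo, ld, t)) }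
      { S₂ with fs := Function.update S₂.fs b (some (lo, ld, u)) } := by
  obtain ⟨ha, rfl⟩ := hab
  have hb : π a ∉ A := fun hA => h.disjoint a ha (by
    have := π.injective (h.fixed _ hA); rwa [this] at hA)
  refine ⟨h.fixed, h.disjoint, fun c hc => ?_, fun c hc => ?_, h.fi, fun c hc => ?_,
    h.fi_left, fun c lo' ld' t' hA hc hk => ?_, h.fi_right, fun c lo' ld' t' hA hc hk => ?_,
    fun c hA => ?_⟩
  · by_cases hca : c = a
    · subst hca; exact .inr (by simp)
    · simpa [dom, hca] using h.mem_left c hc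
  · by_cases hca : c = a
    · subst hca; exact .inr (by simp)
    · simpa [dom, hca] using h.mem_right c hc
  · by_cases hca : c = a
    · subst hca; simp only [Function.update_self]; exact .some ⟨hlo, rfl, rfl, htu⟩
    · simpa [hca] using h.fs c hc
  · by_cases hca : c = a
    · subst hca; exact ha
    · exact h.fs_left c lo' ld' t' hA (by simpa [hca] using hc) hk
  · by_cases hca : c = π a
    · subst hca; simpa using ha
    · exact h.fs_right c lo' ld' t' hA (by simpa [hca] using hc) hk
  · have h₁ : c ≠ a := fun e => h.disjoint a ha (e ▸ hA)
    have h₂ : c ≠ π a := fun e => hb (e ▸ hA)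
    simpa [h₁, h₂] using h.fs_init c hA

theorem upgrade (h : StoreSimilar l A π D S₁ S₂) (k : L) :
    StoreSimilar l A π D { S₁ with fs := S₁.upgraded k } { S₂ with fs := S₂.upgraded k } := by
  refine ⟨h.fixed, h.disjoint, fun c hc => ?_, fun c hc => ?_, h.fi, fun c hc => ?_,
    h.fi_left, fun c lo' ld' t' hA hc hk => ?_, h.fi_right, fun c lo' ld' t' hA hc hk => ?_,
    fun c hA lo ld ld' t t' hc hc' hk => ?_⟩
  · simpa [dom, upgraded] using h.mem_left c hc
  · simpa [dom, upgraded] using h.mem_right c hc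
  · have hr := h.fs c hc
    simp only [upgraded]
    generalize S₁.fs c = c₁ at hr
    generalize S₂.fs (π c) = c₂ at hr
    cases hr with
    | none => exact .none
    | some hcd =>
      obtain ⟨h₁, h₂, h₃, h₄⟩ := hcd
      exact .some ⟨h₁, h₂, by simp [h₃], fun hl => h₄ (le_sup_left.trans hl)⟩
  · obtain ⟨_, hc, -⟩ := upgraded_eq_some.1 hc
    exact h.fs_left _ _ _ _ hA hc hk
  · obtain ⟨_, hc, -⟩ := upgraded_eq_some.1 hc
    exact h.fs_right _ _ _ _ hA hc hk
  · obtain ⟨m, g, rfl⟩ := upgraded_eq_some.1 hc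
    obtain ⟨m', g', rfl⟩ := upgraded_eq_some.1 hc'
    rw [h.fs_init c hA _ _ _ _ _ g g' hk]

/-- Two fresh cells can be linked. -/
theorem alloc (h : StoreSimilar l A π D S₁ S₂) {a b : Addr} (ha : a ∉ S₁.dom) (hb : b ∉ S₂.dom)
    (hA₁ : A ⊆ S₁.dom) (hA₂ : A ⊆ S₂.dom)
    (fi₁ : ∀ c, c ≠ a → S₁'.fi c = S₁.fi c) (fs₁ : ∀ c, c ≠ a → S₁'.fs c = S₁.fs c)
    (fi₂ : ∀ c, c ≠ b → S₂'.fi c = S₂.fi c) (fs₂ : ∀ c, c ≠ b → S₂'.fs c = S₂.fs c)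
    (ha' : a ∈ S₁'.dom) (hb' : b ∈ S₂'.dom)
    (hfi : Option.Rel (SimilarFI l (Linked π D)) (S₁'.fi a) (S₂'.fi b))
    (hfs : Option.Rel (SimilarFS l (Linked π D)) (S₁'.fs a) (S₂'.fs b)) :
    ∃ π' D', (∀ a b, Linked π D a b → Linked π' D' a b) ∧ Linked π' D' a b ∧
      StoreSimilar l A π' D' S₁' S₂' := by
  have haD : a ∉ D := fun h' => ha (h.mem_left a h')
  have haA : a ∉ A := fun h' => ha (hA₁ h')
  have hbA : b ∉ A := fun h' => hb (hA₂ h')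
  set π' : Equiv.Perm Addr := π.trans (Equiv.swap (π a) b) with hπ'
  have hπa : π' a = b := by simp [hπ']
  have hπ_of : ∀ c, c ≠ a → π c ≠ b → π' c = π c := fun c h₁ h₂ => by
    simp only [hπ', Equiv.trans_apply]
    exact Equiv.swap_apply_of_ne_of_ne (fun e => h₁ (π.injective e)) h₂
  have hπD : ∀ c ∈ D, π c ≠ b := fun c hc e => hb (e ▸ h.mem_right c hc)
  have hneD : ∀ c ∈ D, c ≠ a := fun c hc e => haD (e ▸ hc)
  have hD : ∀ c ∈ D, π' c = π c := fun c hc => hπ_of c (hneD c hc) (hπD c hc)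
  have hlink : ∀ c d, Linked π D c d → Linked π' (insert a D) c d := by
    rintro c d ⟨hc, rfl⟩
    exact ⟨.inr hc, hD c hc⟩
  have monoFI : ∀ x y, SimilarFI l (Linked π D) x y → SimilarFI l (Linked π' (insert a D)) x y :=
    fun x y hxy => ⟨hxy.1, fun hl => (hxy.2 hl).mono hlink⟩
  have monoFS : ∀ x y, SimilarFS l (Linked π D) x y → SimilarFS l (Linked π' (insert a D)) x y :=
    fun x y hxy => ⟨hxy.1, hxy.2.1, hxy.2.2.1, fun hl => (hxy.2.2.2 hl).mono hlink⟩
  have relMono : ∀ {α : Type _} {r s : α → α → Prop} {x y : Option α}, (∀ x y, r x y → s x y) →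
      Option.Rel r x y → Option.Rel s x y := by
    intro α r s x y hrs hxy
    cases hxy with
    | none => exact .none
    | some hxy => exact .some (hrs _ _ hxy)
  have symmD : ∀ c, c ≠ b → π.symm c ∈ D → π'.symm c ∈ insert a D := by
    intro c hcb hc
    have : π' (π.symm c) = c := by rw [hD _ hc, Equiv.apply_symm_apply]
    rw [← this, Equiv.symm_apply_apply]
    exact .inr hc
  have symmb : π'.symm b ∈ insert a D := by
    rw [← hπa, Equiv.symm_apply_apply]; exact .inl rfl
  refine ⟨π', insert a D, hlink, ⟨.inl rfl, hπa⟩, ?_, ?_, ?_, ?_, ?_, ?_, ?_, ?_, ?_, ?_, ?_⟩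
  · intro c hc
    rw [hπ_of c (fun e => haA (e ▸ hc)) (by rw [h.fixed c hc]; exact fun e => hbA (e ▸ hc)),
      h.fixed c hc]
  · rintro c (rfl | hc)
    · exact haA
    · exact h.disjoint c hc
  · rintro c (rfl | hc)
    · exact ha'
    · have := h.mem_left c hc
      rwa [dom, Set.mem_ofPred, ← fi₁ c (hneD c hc), ← fs₁ c (hneD c hc)] at this
  · rintro c (rfl | hc)
    · rwa [hπa]
    · have := h.mem_right c hc
      rw [hD c hc]
      rwa [dom, Set.mem_ofPred, ← fi₂ _ (hπD c hc), ← fs₂ _ (hπD c hc)] at this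
  · rintro c (rfl | hc)
    · rw [hπa]; exact relMono monoFI hfi
    · rw [hD c hc, fi₁ c (hneD c hc), fi₂ _ (hπD c hc)]
      exact relMono monoFI (h.fi c hc)
  · rintro c (rfl | hc)
    · rw [hπa]; exact relMono monoFS hfs
    · rw [hD c hc, fs₁ c (hneD c hc), fs₂ _ (hπD c hc)]
      exact relMono monoFS (h.fs c hc)
  · intro c k t hA hc hk
    by_cases hca : c = a
    · exact .inl hca
    · exact .inr (h.fi_left c k t hA (fi₁ c hca ▸ hc) hk)
  · intro c lo ld t hA hc hk
    by_cases hca : c = a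
    · exact .inl hca
    · exact .inr (h.fs_left c lo ld t hA (fs₁ c hca ▸ hc) hk)
  · intro c k t hA hc hk
    by_cases hcb : c = b
    · exact hcb ▸ symmb
    · exact symmD c hcb (h.fi_right c k t hA (fi₂ c hcb ▸ hc) hk)
  · intro c lo ld t hA hc hk
    by_cases hcb : c = b
    · exact hcb ▸ symmb
    · exact symmD c hcb (h.fs_right c lo ld t hA (fs₂ c hcb ▸ hc) hk)
  · intro c hA lo ld ld' t t' hc hc' hk
    rw [fs₁ c fun e => haA (e ▸ hA)] at hc
    rw [fs₂ c fun e => hbA (e ▸ hA)] at hc'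
    exact h.fs_init c hA lo ld ld' t t' hc hc' hk

theorem fi_cells (h : StoreSimilar l A π D S₁ S₂) {a b : Addr} (hab : Linked π D a b) {k k' : L}
    {t u : Term L} (h₁ : S₁.fi a = some (k, t)) (h₂ : S₂.fi b = some (k', u)) :
    k = k' ∧ (k ≤ l → Similar l (Linked π D) t u) := by
  obtain ⟨ha, rfl⟩ := hab
  have hr := h.fi a ha
  rw [h₁, h₂] at hr
  cases hr with | some hr => exact hr

theorem fs_cells (h : StoreSimilar l A π D S₁ S₂) {a b : Addr} (hab : Linked π D a b)
    {lo ld lo' ld' : L} {t u : Term L} (h₁ : S₁.fs a = some (lo, ld, t))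
    (h₂ : S₂.fs b = some (lo', ld', u)) :
    lo ≤ l ∧ lo = lo' ∧ ld = ld' ∧ (ld ≤ l → Similar l (Linked π D) t u) := by
  obtain ⟨ha, rfl⟩ := hab
  have hr := h.fs a ha
  rw [h₁, h₂] at hr
  cases hr with | some hr => exact hr

end StoreSimilar

end FlowSens

namespace FlowSens

open Env

variable {L : Type*} [Lattice L]

/-- Either the current labels are the same visible label and the terms are similar, or neither of
the current labels is visible. -/
def SimilarConf (l : L) (P : Addr → Addr → Prop) (S₁ : Env L) (t₁ : Term L) (S₂ : Env L)
    (t₂ : Term L) : Prop :=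
  (S₁.cur = S₂.cur ∧ S₁.cur ≤ l ∧ Similar l P t₁ t₂) ∨ (¬ S₁.cur ≤ l ∧ ¬ S₂.cur ≤ l)

theorem Act.similar {l : L} {A D : Set Addr} {π : Equiv.Perm Addr} {S₁ S₂ S₁' S₂' : Env L}
    {t₁ t₂ t₁' t₂' : Term L} (h₁ : Act S₁ t₁ S₁' t₁') (h₂ : Act S₂ t₂ S₂' t₂')
    (ht : Similar l (Linked π D) t₁ t₂) (hcur : S₁.cur = S₂.cur) (hl : S₁.cur ≤ l)
    (hS : StoreSimilar l A π D S₁ S₂) (hA₁ : A ⊆ S₁.dom) (hA₂ : A ⊆ S₂.dom) :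
    ∃ π' D', (∀ a b, Linked π D a b → Linked π' D' a b) ∧ StoreSimilar l A π' D' S₁' S₂' ∧
      SimilarConf l (Linked π' D') S₁' t₁' S₂' t₂' := by
  cases h₁ with
  | ret =>
    cases ht with | un ht => cases h₂; exact ⟨π, D, fun _ _ => id, hS, .inl ⟨hcur, hl, .lio ht⟩⟩
  | getLabel =>
    cases ht
    cases h₂
    exact ⟨π, D, fun _ _ => id, hS, .inl ⟨hcur, hl, hcur ▸ .un .lbl⟩⟩
  | label _ =>
    cases ht with
    | bin ht ht' =>
      cases ht
      cases h₂
      exact ⟨π, D, fun _ _ => id, hS, .inl ⟨hcur, hl, .un (.lb fun _ => ht')⟩⟩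
  | @unlabel k _ _ =>
    cases ht with
    | un ht =>
      cases ht with
      | lb ht =>
        cases h₂
        refine ⟨π, D, fun _ _ => id, ?_, ?_⟩
        · rw [← hcur]; exact (hS.upgrade _).setCur _ _
        · by_cases hk : k ≤ l
          · exact .inl ⟨by simp [hcur], sup_le hl hk, .un (ht hk)⟩
          · exact .inr ⟨fun h => hk (le_sup_right.trans h), fun h => hk (le_sup_right.trans h)⟩
  | upgradeStore _ =>
    cases ht
    cases h₂
    exact ⟨π, D, fun _ _ => id, hS.upgrade _, .inl ⟨hcur, hl, .lio .unit⟩⟩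
  | @newRefFI k t a _ ha =>
    cases ht with
    | @bin _ _ _ _ u ht ht' =>
      cases ht
      cases h₂ with
      | @newRefFI _ _ b _ hb =>
        obtain ⟨π', D', h, hab, hS'⟩ := hS.alloc ha hb hA₁ hA₂
          (S₁' := { S₁ with fi := Function.update S₁.fi a (some (k, t)) })
          (S₂' := { S₂ with fi := Function.update S₂.fi b (some (k, u)) })
          (fun c hc => Function.update_of_ne hc _ _) (fun _ _ => rfl)
          (fun c hc => Function.update_of_ne hc _ _) (fun _ _ => rfl)
          (.inl (by simp)) (.inl (by simp)) (by simp only [Function.update_self]; exact .some ⟨rfl, fun _ => ht'⟩)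
          (by simp [fs_eq_none_of_notMem_dom ha, fs_eq_none_of_notMem_dom hb])
        exact ⟨π', D', h, hS', .inl ⟨hcur, hl, .un (.refFI hab)⟩⟩
  | readRefFI hc =>
    cases ht with
    | un ht =>
      cases ht with
      | refFI hab =>
        cases h₂ with
        | readRefFI hc' =>
          obtain ⟨rfl, h⟩ := hS.fi_cells hab hc hc'
          exact ⟨π, D, fun _ _ => id, hS, .inl ⟨hcur, hl, .un (.lb h)⟩⟩
  | writeRefFI _ =>
    cases ht with
    | bin ht ht' =>
      cases ht with
      | refFI hab =>
        cases h₂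
        exact ⟨π, D, fun _ _ => id, hS.updateFI hab fun _ => ht', .inl ⟨hcur, hl, .un .unit⟩⟩
  | copyRef hle _ hc =>
    cases ht with
    | bin ht ht' =>
      cases ht with
      | refFI hab =>
        cases ht' with
        | refFI hab' =>
          cases h₂ with
          | copyRef _ _ hc' =>
            exact ⟨π, D, fun _ _ => id,
              hS.updateFI hab' fun h => (hS.fi_cells hab hc hc').2 (hle.trans h),
              .inl ⟨hcur, hl, .un .unit⟩⟩
  | @newRefFS k t a _ ha =>
    cases ht with
    | @bin _ _ _ _ u ht ht' =>
      cases ht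
      cases h₂ with
      | @newRefFS _ _ b _ hb =>
        obtain ⟨π', D', h, hab, hS'⟩ := hS.alloc ha hb hA₁ hA₂
          (S₁' := { S₁ with fs := Function.update S₁.fs a (some (S₁.cur, k, t)) })
          (S₂' := { S₂ with fs := Function.update S₂.fs b (some (S₂.cur, k, u)) })
          (fun _ _ => rfl) (fun c hc => Function.update_of_ne hc _ _)
          (fun _ _ => rfl) (fun c hc => Function.update_of_ne hc _ _)
          (.inr (by simp)) (.inr (by simp))
          (by simp [fi_eq_none_of_notMem_dom ha, fi_eq_none_of_notMem_dom hb])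
          (by simp only [Function.update_self]; exact .some ⟨hl, hcur, rfl, fun _ => ht'⟩)
        exact ⟨π', D', h, hS', .inl ⟨hcur, hl, .un (.refFS hab)⟩⟩
  | readRefFS hc =>
    cases ht with
    | un ht =>
      cases ht with
      | refFS hab =>
        cases h₂ with
        | readRefFS hc' =>
          obtain ⟨_, rfl, rfl, h⟩ := hS.fs_cells hab hc hc'
          exact ⟨π, D, fun _ _ => id, hS,
            .inl ⟨hcur, hl, .un (.lb fun hk => h (le_sup_right.trans hk))⟩⟩
  | writeRefFS hc hle =>
    cases ht with
    | bin ht ht' =>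
      cases ht with
      | refFS hab =>
        cases h₂ with
        | writeRefFS hc' _ =>
          obtain ⟨hlo, rfl, rfl, -⟩ := hS.fs_cells hab hc hc'
          exact ⟨π, D, fun _ _ => id, hS.updateFS hab hlo fun _ => ht',
            .inl ⟨hcur, hl, .un .unit⟩⟩
        | writeRefFSFail hc' hle' =>
          obtain ⟨-, rfl, rfl, -⟩ := hS.fs_cells hab hc hc'
          exact absurd (hcur ▸ hle) hle'
  | writeRefFSFail hc hle =>
    cases ht with
    | bin ht ht' =>
      cases ht with
      | refFS hab =>
        cases h₂ with
        | writeRefFS hc' hle' =>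
          obtain ⟨-, rfl, rfl, -⟩ := hS.fs_cells hab hc hc'
          exact absurd (hcur ▸ hle') hle
        | writeRefFSFail hc' _ =>
          obtain ⟨-, rfl, rfl, -⟩ := hS.fs_cells hab hc hc'
          exact ⟨π, D, fun _ _ => id, hS, .inl ⟨hcur, hl, .un (.lb fun _ => .diverge)⟩⟩
  | labelOfFS hc =>
    cases ht with
    | un ht =>
      cases ht with
      | refFS hab =>
        cases h₂ with
        | labelOfFS hc' =>
          obtain ⟨_, rfl, rfl, -⟩ := hS.fs_cells hab hc hc'
          exact ⟨π, D, fun _ _ => id, hS, .inl ⟨hcur, hl, .un (.lb fun _ => .lbl)⟩⟩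
  | upgrade hc _ =>
    cases ht with
    | bin ht ht' =>
      cases ht with
      | refFS hab =>
        cases ht'
        cases h₂ with
        | upgrade hc' _ =>
          obtain ⟨hlo, rfl, rfl, h⟩ := hS.fs_cells hab hc hc'
          exact ⟨π, D, fun _ _ => id,
            hS.updateFS hab hlo fun hk => h (le_sup_left.trans hk), .inl ⟨hcur, hl, .un .unit⟩⟩
  | downgrade hc _ =>
    cases ht with
    | bin ht ht' =>
      cases ht with
      | refFS hab =>
        cases ht'
        cases h₂ with
        | downgrade hc' _ =>
          obtain ⟨hlo, rfl, rfl, h⟩ := hS.fs_cells hab hc hc'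
          exact ⟨π, D, fun _ _ => id, hS.updateFS hab hlo fun _ => .diverge,
            .inl ⟨hcur, hl, .un .unit⟩⟩

/-- Two runs that continue from invisible current labels keep the stores similar. -/
theorem StoreSimilar.eval_invisible {l : L} {D : Set Addr} {π : Equiv.Perm Addr}
    {S₀ S₁ S₂ S₁' S₂' : Env L} {t₁ t₂ v₁ v₂ : Term L} (hS : StoreSimilar l S₀.dom π D S₁ S₂)
    (hu₁ : Unreached S₀ S₁) (hu₂ : Unreached S₀ S₂) (hs₁ : SafeRefs S₀.dom S₁ t₁)
    (hs₂ : SafeRefs S₀.dom S₂ t₂) (hl₁ : ¬ S₁.cur ≤ l) (hl₂ : ¬ S₂.cur ≤ l)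
    (h₁ : Eval S₁ t₁ S₁' v₁) (h₂ : Eval S₂ t₂ S₂' v₂) :
    StoreSimilar l S₀.dom π D S₁' S₂' ∧ ¬ S₁'.cur ≤ l ∧ ¬ S₂'.cur ≤ l := by
  obtain ⟨g₁, f₁⟩ := h₁.invisible hu₁ hs₁ hl₁
  obtain ⟨g₂, f₂⟩ := h₂.invisible hu₂ hs₂ hl₂
  exact ⟨hS.invisible g₁ g₂, f₁, f₂⟩

/-- Two terminating runs from similar configurations end in similar configurations. -/
theorem Eval.similar {l : L} {S₀ S₁ S₁' : Env L} {t₁ v₁ : Term L} (h₁ : Eval S₁ t₁ S₁' v₁)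
    {D : Set Addr} {π : Equiv.Perm Addr} {S₂ S₂' : Env L} {t₂ v₂ : Term L}
    (h₂ : Eval S₂ t₂ S₂' v₂) (hS : StoreSimilar l S₀.dom π D S₁ S₂)
    (hu₁ : Unreached S₀ S₁) (hu₂ : Unreached S₀ S₂) (hs₁ : SafeRefs S₀.dom S₁ t₁)
    (hs₂ : SafeRefs S₀.dom S₂ t₂) (hc : SimilarConf l (Linked π D) S₁ t₁ S₂ t₂) :
    ∃ π' D', (∀ a b, Linked π D a b → Linked π' D' a b) ∧ StoreSimilar l S₀.dom π' D' S₁' S₂' ∧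
      SimilarConf l (Linked π' D') S₁' v₁ S₂' v₂ := by
  induction h₁ generalizing D π S₂ S₂' t₂ v₂ with
  | val hv =>
    rcases hc with ⟨hcur, hl, ht⟩ | ⟨hl₁, hl₂⟩
    · obtain ⟨rfl, rfl⟩ := h₂.of_isValue (ht.isValue hv)
      exact ⟨π, D, fun _ _ => id, hS, .inl ⟨hcur, hl, ht⟩⟩
    · obtain ⟨g, f⟩ := hS.eval_invisible hu₁ hu₂ hs₁ hs₂ hl₁ hl₂ (.val hv) h₂
      exact ⟨π, D, fun _ _ => id, g, .inr f⟩
  | pure hp h₁ ih =>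
    rcases hc with ⟨hcur, hl, ht⟩ | ⟨hl₁, hl₂⟩
    · obtain ⟨u, hp', ht'⟩ := ht.pureStep hp
      cases h₂ with
      | val hv => exact absurd hv hp'.not_isValue
      | pure hp₂ h₂ =>
        cases hp'.deterministic hp₂
        exact ih h₂ hS hu₁ hu₂ (hs₁.pureStep hp) (hs₂.pureStep hp₂) (.inl ⟨hcur, hl, ht'⟩)
      | act ha _ => exact absurd ha hp'.not_act
      | bind _ _ => exact absurd hp' not_pureStep_bind
      | toLabeled _ _ _ _ => exact absurd hp' not_pureStep_toLabeled
    · obtain ⟨g, f⟩ := hS.eval_invisible hu₁ hu₂ hs₁ hs₂ hl₁ hl₂ (.pure hp h₁) h₂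
      exact ⟨π, D, fun _ _ => id, g, .inr f⟩
  | act ha h₁ ih =>
    rcases hc with ⟨hcur, hl, ht⟩ | ⟨hl₁, hl₂⟩
    · cases h₂ with
      | val hv => exact absurd (ht.symm.isValue hv) ha.not_isValue
      | pure hp _ =>
        obtain ⟨_, hp', -⟩ := ht.symm.pureStep hp
        exact absurd ha hp'.not_act
      | act ha₂ h₂ =>
        obtain ⟨π₁, D₁, e₁, g, f⟩ := ha.similar ha₂ ht hcur hl hS hu₁.dom_subset hu₂.dom_subset
        obtain ⟨hu₁', -, hs₁'⟩ := ha.safe hu₁ hs₁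
        obtain ⟨hu₂', -, hs₂'⟩ := ha₂.safe hu₂ hs₂
        obtain ⟨π₂, D₂, e₂, g', f'⟩ := ih h₂ g hu₁' hu₂' hs₁' hs₂' f
        exact ⟨π₂, D₂, fun a b h => e₂ a b (e₁ a b h), g', f'⟩
      | bind _ _ => cases ht; cases ha
      | toLabeled _ _ _ _ => cases ht; cases ha
    · obtain ⟨g, f⟩ := hS.eval_invisible hu₁ hu₂ hs₁ hs₂ hl₁ hl₂ (.act ha h₁) h₂
      exact ⟨π, D, fun _ _ => id, g, .inr f⟩
  | bind h₁ h₁' ih ih' =>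
    rcases hc with ⟨hcur, hl, ht⟩ | ⟨hl₁, hl₂⟩
    · cases ht with
      | bin ht ht' =>
        obtain ⟨T, w, h₂, h₂'⟩ := h₂.bind_inv
        obtain ⟨π₁, D₁, e₁, g, f⟩ := ih h₂ hS hu₁ hu₂ hs₁.1 hs₂.1 (.inl ⟨hcur, hl, ht⟩)
        obtain ⟨hu₁', he₁, hs₁'⟩ := h₁.safe hu₁ hs₁.1
        obtain ⟨hu₂', he₂, hs₂'⟩ := h₂.safe hu₂ hs₂.1
        obtain ⟨π₂, D₂, e₂, g', f'⟩ := ih' h₂' g hu₁' hu₂' ⟨he₁.safeRefs hs₁.2, hs₁'⟩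
          ⟨he₂.safeRefs hs₂.2, hs₂'⟩ (f.imp_left fun ⟨q₁, q₂, q₃⟩ => ⟨q₁, q₂, by
            cases q₃ with | lio q₃ => exact .bin (ht'.mono e₁) q₃⟩)
        exact ⟨π₂, D₂, fun a b h => e₂ a b (e₁ a b h), g', f'⟩
    · obtain ⟨g, f⟩ := hS.eval_invisible hu₁ hu₂ hs₁ hs₂ hl₁ hl₂ (.bind h₁ h₁') h₂
      exact ⟨π, D, fun _ _ => id, g, .inr f⟩
  | toLabeled hk h₁ hk' h₁' ih _ =>
    rcases hc with ⟨hcur, hl, ht⟩ | ⟨hl₁, hl₂⟩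
    · cases ht with
      | bin ht ht' =>
        cases ht
        obtain ⟨T₂, w₂, h₂, -, h₂'⟩ := h₂.toLabeled_inv
        obtain ⟨π₁, D₁, e₁, g, f⟩ := ih h₂ hS hu₁ hu₂ hs₁.2 hs₂.2 (.inl ⟨hcur, hl, ht'⟩)
        obtain ⟨rfl, rfl⟩ := h₁'.label_inv
        obtain ⟨rfl, rfl⟩ := h₂'.label_inv
        refine ⟨π₁, D₁, e₁, g.setCur _ _, .inl ⟨hcur, hl, .lio (.lb fun hkl => ?_)⟩⟩
        rcases f with ⟨-, -, f⟩ | ⟨f, -⟩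
        · cases f with | lio f => exact f
        · exact absurd (hk'.trans hkl) f
    · obtain ⟨g, f⟩ := hS.eval_invisible hu₁ hu₂ hs₁ hs₂ hl₁ hl₂ (.toLabeled hk h₁ hk' h₁') h₂
      exact ⟨π, D, fun _ _ => id, g, .inr f⟩

theorem mapAddr_erase_of_refsOK {l : L} {S : Env L} {π : Addr → Addr} (hπ : ∀ a ∈ S.dom, π a = a)
    {t : Term L} (ht : S.RefsOK t) : (t.erase l).mapAddr π = t.erase l := by
  induction t with
  | refFI k a =>
    obtain ⟨t, ht⟩ := ht
    simp [Term.erase, Term.mapAddr, hπ a (.inl (by simp [ht]))]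
  | refFS a =>
    obtain ⟨t, ht⟩ := ht
    simp [Term.erase, Term.mapAddr, hπ a (.inr (by simp [ht]))]
  | lb k t ih =>
    by_cases hk : k ≤ l
    · simp [Term.erase, Term.mapAddr, hk, ih ht]
    · simp [Term.erase, Term.mapAddr, hk]
  | lam t ih | lio t ih | un o t ih => simp [Term.erase, Term.mapAddr, ih ht]
  | bin o t u iht ihu => simp [Term.erase, Term.mapAddr, iht ht.1, ihu ht.2]
  | ite t u w iht ihu ihw => simp [Term.erase, Term.mapAddr, iht ht.1, ihu ht.2.1, ihw ht.2.2]
  | _ => rfl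

namespace StoreSimilar

variable {l : L} {D : Set Addr} {π : Equiv.Perm Addr} {S₀ S₁ S₂ : Env L}

theorem eraseFI (h : StoreSimilar l S₀.dom π D S₁ S₂) (hS₀ : S₀.WellFormed)
    (hu₁ : Unreached S₀ S₁) (hu₂ : Unreached S₀ S₂) (t₁ t₂ : Term L) (a : Addr) :
    ((eraseConf l S₁ t₁).permute π).fi (π a) = (eraseConf l S₂ t₂).fi (π a) := by
  simp only [ErasedConf.permute, eraseConf, Equiv.symm_apply_apply]
  by_cases hA : a ∈ S₀.dom
  · rw [h.fixed a hA, hu₁.fi_init a hA, hu₂.fi_init a hA]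
    cases hc : S₀.fi a with
    | none => rfl
    | some c =>
      obtain ⟨k, t⟩ := c
      by_cases hk : k ≤ l
      · simp [hk, mapAddr_erase_of_refsOK h.fixed (hS₀.fi_ok a k t hc)]
      · simp [hk]
  · have hA' : π a ∉ S₀.dom := fun hA' => hA (by
      have := π.injective (h.fixed _ hA'); rwa [this] at hA')
    by_cases hD : a ∈ D
    · have hr := h.fi a hD
      generalize S₁.fi a = c at hr
      generalize S₂.fi (π a) = d at hr
      cases hr with
      | none => rfl
      | @some c d hcd =>
        obtain ⟨k, t⟩ := c
        obtain ⟨k', u⟩ := d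
        obtain ⟨hk, hs⟩ := hcd
        dsimp only at hk hs
        subst hk
        by_cases hk : k ≤ l
        · simp [hk, (hs hk).mapAddr_erase fun _ _ h => h.2]
        · simp [hk]
    · trans none
      · cases hc : S₁.fi a with
        | none => rfl
        | some c =>
          have : ¬ c.1 ≤ l := fun hk => hD (h.fi_left a c.1 c.2 hA hc hk)
          simp [this]
      · cases hc : S₂.fi (π a) with
        | none => rfl
        | some c =>
          have : ¬ c.1 ≤ l := fun hk => hD (by
            simpa using h.fi_right (π a) c.1 c.2 hA' hc hk)
          simp [this]

theorem eraseFS (h : StoreSimilar l S₀.dom π D S₁ S₂) (hS₀ : S₀.WellFormed)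
    (hu₁ : Unreached S₀ S₁) (hu₂ : Unreached S₀ S₂) (t₁ t₂ : Term L) (a : Addr) :
    ((eraseConf l S₁ t₁).permute π).fs (π a) = (eraseConf l S₂ t₂).fs (π a) := by
  simp only [ErasedConf.permute, eraseConf, Equiv.symm_apply_apply]
  by_cases hA : a ∈ S₀.dom
  · rw [h.fixed a hA]
    have h₁ := hu₁.fs_init a hA
    have h₂ := hu₂.fs_init a hA
    cases hc : S₀.fs a with
    | none =>
      simp only [hc, Option.map_none, Option.map_eq_none_iff] at h₁ h₂
      simp [h₁, h₂]
    | some c =>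
      obtain ⟨k, ld, t⟩ := c
      simp only [hc, Option.map_some, Option.map_eq_some_iff] at h₁ h₂
      obtain ⟨⟨k₁, ld₁, t₁⟩, hc₁, e₁⟩ := h₁
      obtain ⟨⟨k₂, ld₂, t₂⟩, hc₂, e₂⟩ := h₂
      simp only [Prod.mk.injEq] at e₁ e₂
      obtain ⟨rfl, rfl⟩ := e₁
      obtain ⟨rfl, rfl⟩ := e₂
      by_cases hk : k₂ ≤ l
      · obtain rfl := h.fs_init a hA _ _ _ _ _ hc₁ hc₂ hk
        by_cases hd : ld₁ ≤ l
        · simp [hc₁, hc₂, hk, hd, mapAddr_erase_of_refsOK h.fixed (hS₀.fs_ok a _ _ _ hc)]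
        · simp [hc₁, hc₂, hk, hd, Term.mapAddr]
      · simp [hc₁, hc₂, hk]
  · have hA' : π a ∉ S₀.dom := fun hA' => hA (by
      have := π.injective (h.fixed _ hA'); rwa [this] at hA')
    by_cases hD : a ∈ D
    · have hr := h.fs a hD
      generalize S₁.fs a = c at hr
      generalize S₂.fs (π a) = d at hr
      cases hr with
      | none => rfl
      | @some c d hcd =>
        obtain ⟨k, ld, t⟩ := c
        obtain ⟨k', ld', u⟩ := d
        obtain ⟨hlo, hk, hd, hs⟩ := hcd
        dsimp only at hlo hk hd hs
        subst hk hd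
        by_cases hd : ld ≤ l
        · simp [hlo, hd, (hs hd).mapAddr_erase fun _ _ h => h.2]
        · simp [hlo, hd, Term.mapAddr]
    · trans none
      · cases hc : S₁.fs a with
        | none => rfl
        | some c =>
          have : ¬ c.1 ≤ l := fun hk => hD (h.fs_left a c.1 c.2.1 c.2.2 hA hc hk)
          simp [this]
      · cases hc : S₂.fs (π a) with
        | none => rfl
        | some c =>
          have : ¬ c.1 ≤ l := fun hk => hD (by
            simpa using h.fs_right (π a) c.1 c.2.1 c.2.2 hA' hc hk)
          simp [this]

theorem confEquiv (h : StoreSimilar l S₀.dom π D S₁ S₂) (hS₀ : S₀.WellFormed)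
    (hu₁ : Unreached S₀ S₁) (hu₂ : Unreached S₀ S₂) {t₁ t₂ : Term L}
    (hc : SimilarConf l (Linked π D) S₁ t₁ S₂ t₂) : ConfEquiv l S₀.dom S₁ t₁ S₂ t₂ := by
  have htop : ((eraseConf l S₁ t₁).permute π).cur = (eraseConf l S₂ t₂).cur ∧
      ((eraseConf l S₁ t₁).permute π).tm = (eraseConf l S₂ t₂).tm := by
    rcases hc with ⟨hcur, hl, ht⟩ | ⟨hl₁, hl₂⟩
    · simp [eraseConf, ErasedConf.permute, ← hcur, hl, ht.mapAddr_erase fun _ _ h => h.2]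
    · simp [eraseConf, ErasedConf.permute, hl₁, hl₂, Term.mapAddr]
  refine ⟨π, h.fixed, ErasedConf.ext htop.1 (funext fun b => ?_) (funext fun b => ?_) htop.2⟩
  · obtain ⟨a, rfl⟩ := π.surjective b
    exact h.eraseFI hS₀ hu₁ hu₂ t₁ t₂ a
  · obtain ⟨a, rfl⟩ := π.surjective b
    exact h.eraseFS hS₀ hu₁ hu₂ t₁ t₂ a

theorem refl (l : L) (S : Env L) : StoreSimilar l S.dom 1 ∅ S S where
  fixed _ _ := rfl
  disjoint _ h := h.elim
  mem_left _ h := h.elim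
  mem_right _ h := h.elim
  fi _ h := h.elim
  fs _ h := h.elim
  fi_left a k t ha hc := (ha (.inl (by simp [hc]))).elim
  fs_left a lo ld t ha hc := (ha (.inr (by simp [hc]))).elim
  fi_right a k t ha hc := (ha (.inl (by simp [hc]))).elim
  fs_right a lo ld t ha hc := (ha (.inr (by simp [hc]))).elim
  fs_init a ha lo ld ld' t t' hc hc' _ := by
    rw [hc] at hc'
    cases hc'
    rfl

end StoreSimilar

end FlowSens

theorem mainTheorem3 {L : Type*} [Lattice L] (l : L)
    (S : FlowSens.Env L) (hS : S.WellFormed)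
    (Δ : FlowSens.Sens → FlowSens.Addr → Option FlowSens.Ty)
    (t₁ t₂ : FlowSens.Term L) (τ₁ τ₂ : FlowSens.Ty)
    (ht₁ : FlowSens.HasType Δ [] t₁ (.lio τ₁)) (ht₂ : FlowSens.HasType Δ [] t₂ (.lio τ₂))
    (hn₁ : t₁.NoTCBExceptLb) (hn₂ : t₂.NoTCBExceptLb)
    (heq : FlowSens.TermEquiv l t₁ t₂)
    (S₁ S₂ : FlowSens.Env L) (v₁ v₂ : FlowSens.Term L)
    (hv₁ : v₁.IsValue) (hv₂ : v₂.IsValue)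
    (hr₁ : FlowSens.Steps S t₁ S₁ v₁) (hr₂ : FlowSens.Steps S t₂ S₂ v₂) :
    FlowSens.ConfEquiv l S.dom S₁ v₁ S₂ v₂ := by
  have e₁ := hr₁.eval hv₁
  have e₂ := hr₂.eval hv₂
  have s₁ := FlowSens.Env.SafeRefs.of_noTCB (A := S.dom) (S := S) hn₁
  have s₂ := FlowSens.Env.SafeRefs.of_noTCB (A := S.dom) (S := S) hn₂
  have hc : FlowSens.SimilarConf l (FlowSens.Linked 1 ∅) S t₁ S t₂ := by
    by_cases hl : S.cur ≤ l
    · exact .inl ⟨rfl, hl, .of_erase_eq hn₁ heq⟩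
    · exact .inr ⟨hl, hl⟩
  obtain ⟨π, D, -, h, hc'⟩ := e₁.similar e₂ (.refl l S) .refl .refl s₁ s₂ hc
  exact h.confEquiv hS (e₁.safe .refl s₁).1 (e₂.safe .refl s₂).1 hc'
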